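/- Let $T$ be a tree (a connected acyclic graph on a non-empty vertex set $V(T)$ of arbitrary finite or infinite cardinality $|T|$). Let $\operatorname{Aut}(T)$ be its automorphism group, and suppose that $T$ has finite motion $m$, that is, $T$ has a non-identity automorphism, and $m \in \mathbb{N}$ is the minimum number of vertices moved by the non-identity automorphisms of $T$. Let $\Delta(T)$ be the least upper bound of the degrees of the vertices of $T$, and suppose that $\Delta(T) \le 2^{m/2}$. A set $S \subseteq V(T)$ is called distinguishing if the identity is the only $\varphi \in \operatorname{Aut}(T)$ with $\varphi(S) = S$. Two sets $S, S'$ are equivalent if $\varphi(S) = S'$ for some $\varphi \in \operatorname{Aut}(T)$, and $a(T)$ denotes the cardinal number of equivalence classes of distinguishing sets of $T$. Then: (i) $T$ is $2$-distinguishable, that is, $T$ has a distinguishing set; (ii) if $T$ is infinite, then $a(T) = 2^{|T|}$. -/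

import Mathlib

open Cardinal
open scoped ENNReal

namespace SimpleGraph

universe u

/-- `S` is distinguishing: the identity is the only automorphism of `G` that fixes `S` setwise. -/
def IsDistinguishing {V : Type u} (G : SimpleGraph V) (S : Set V) : Prop :=
  ∀ φ : G ≃g G, φ '' S = S → φ = Iso.refl

/-- `G` is 2-distinguishable: it has a distinguishing set of vertices. -/
def TwoDistinguishable {V : Type u} (G : SimpleGraph V) : Prop :=
  ∃ S : Set V, G.IsDistinguishing S

/-- Two distinguishing sets are equivalent if some automorphism of `G` maps one onto the other. -/
def distinguishingSetoid {V : Type u} (G : SimpleGraph V) :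
    Setoid {S : Set V // G.IsDistinguishing S} where
  r S S' := ∃ φ : G ≃g G, φ '' S.1 = S'.1
  iseqv :=
    { refl := fun S => ⟨Iso.refl, Set.image_id S.1⟩
      symm := by
        rintro S S' ⟨φ, h⟩
        refine ⟨φ.symm, ?_⟩
        rw [← h]
        exact φ.toEquiv.symm_image_image S.1
      trans := by
        rintro S S' S'' ⟨φ, h⟩ ⟨ψ, k⟩
        refine ⟨φ.trans ψ, ?_⟩
        rw [← k, ← h, ← Set.image_comp]
        rfl }

/-- The asymmetrizing number `a(G)`: the number (a cardinal) of equivalence classes of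
distinguishing sets. -/
noncomputable def asymmetrizingNumber {V : Type u} (G : SimpleGraph V) : Cardinal.{u} :=
  #(Quotient G.distinguishingSetoid)

/-- `G` has motion `κ`: `κ` is the minimum number of vertices moved by the non-identity
automorphisms of `G`. An asymmetric graph has no cardinal as its motion, in accordance with the
convention that its motion exceeds every cardinal. -/
def HasMotion {V : Type u} (G : SimpleGraph V) (κ : Cardinal.{u}) : Prop :=
  IsLeast {c : Cardinal.{u} | ∃ φ : G ≃g G, φ ≠ Iso.refl ∧ c = #{v : V // φ v ≠ v}} κ

/-- `Δ(G)`: the least upper bound (a cardinal) of the degrees of the vertices of `G`. -/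
noncomputable def degreeSup {V : Type u} (G : SimpleGraph V) : Cardinal.{u} :=
  ⨆ v : V, #(G.neighborSet v)

end SimpleGraph

/-!
A tree is rooted at a vertex, or at an end if it is infinite, and the rooting is encoded by its
parent map `π`; the branch `below π v` consists of the descendants of `v`. Let `N` be the supremum
of the degrees, so that `N ^ 2 ≤ 2 ^ m`.

*Finite branches.* If an automorphism carries a vertex to a sibling with a different, finite
branch, then exchanging the two branches is an automorphism that moves twice as many vertices as
the branch has, so the branch has at least `m / 2` vertices (`Branching.le_two_mul_ncard`). A finite
branch with at least `m / 2` vertices has at least `N` pairwise inequivalent colourings without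
symmetries (`Branching.exists_good_and_rich`). Indeed, if the branches at the children of its top
vertex all have fewer than `m / 2` vertices, then it has no symmetries at all, and its
`2 ^ (m / 2) ≥ N` or more colourings will do. Otherwise, by induction, the branch at one of the
children has `N` such colourings. If this sub-branch has `k` isomorphic siblings, itself included,
then `1 ≤ k < N`, and the `N.choose k ≥ N` choices of `k` of these colourings give inequivalent
colourings of the whole. It follows that all children of a vertex that have finite
branches can be coloured greedily, so that their branches are without symmetries and pairwise
inequivalent.

*Finite trees.* Root the tree at a centroid. The preceding construction breaks all automorphisms
that fix the centroid. The colour of the centroid is still free, and is chosen so that the number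
of coloured vertices is odd. An automorphism that moves the centroid exchanges the two halves of
the tree at an edge, so it preserves no set of odd size.

*Infinite trees.* The degrees are bounded, so the tree is countable and contains a ray; root it at
the end of this ray. Outside of the ray, the colour of the vertices with infinite branches is given
by a sparse set `K` that meets every infinite branch and has at most one element in each of the
levels below the origin of the ray. The ray itself is coloured except at a sparse set of positions.
As no ray to another end has infinitely many pairs of adjacent coloured vertices, an automorphism
that preserves the colours fixes the end. Since the exceptional positions are sparse, it does not
translate along the ray, hence it preserves the levels. So it fixes `K`, then all vertices with
infinite branches, and finally the finite branches, which are coloured as above. The exceptional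
positions can be taken from an almost disjoint family of size continuum, and different members
of the family give inequivalent colourings.
-/

namespace ParentMap

/-! ### Branches of a parent map -/

section Branches

variable {V : Type*} {π : V → V} {g : Equiv.Perm V} {x y z v w : V} {S S' : Set V}

/-- The branch at `v`: the vertices from which `v` is reached by iterating the parent map `π`. -/
def below (π : V → V) (v : V) : Set V := {x | ∃ n, π^[n] x = v}

/-- The children of `v`. The root, if there is one, is encoded as a fixed point of `π`, and it is
not a child of itself. -/
def kids (π : V → V) (v : V) : Set V := {y | π y = v ∧ y ≠ v}

/-- The only cycles of `π` are fixed points. -/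
def Acyclic (π : V → V) : Prop := ∀ x n, π^[n + 1] x = x → π x = x

theorem self_mem_below (v : V) : v ∈ below π v := ⟨0, rfl⟩

theorem mem_below_trans (h : x ∈ below π y) (h' : y ∈ below π z) : x ∈ below π z := by
  obtain ⟨a, rfl⟩ := h
  obtain ⟨b, rfl⟩ := h'
  exact ⟨b + a, Function.iterate_add_apply _ _ _ _⟩

theorem below_subset (h : x ∈ below π y) : below π x ⊆ below π y := fun _ hz =>
  mem_below_trans hz h

theorem mem_below_of_parent (h : π x ∈ below π v) : x ∈ below π v := by
  obtain ⟨n, hn⟩ := h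
  exact ⟨n + 1, hn⟩

theorem parent_mem_below (h : x ∈ below π v) (hne : x ≠ v) : π x ∈ below π v := by
  obtain ⟨n, hn⟩ := h
  cases n with
  | zero => exact absurd hn hne
  | succ n => exact ⟨n, hn⟩

theorem mem_below_of_mem_kids (h : y ∈ kids π v) : y ∈ below π v := ⟨1, h.1⟩

theorem eq_or_exists_kid (h : x ∈ below π v) : x = v ∨ ∃ y ∈ kids π v, x ∈ below π y := by
  obtain ⟨n, hn⟩ := h
  induction n with
  | zero => exact Or.inl hn
  | succ n ih =>
    by_cases hz : π^[n] x = v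
    · exact ih hz
    · refine Or.inr ⟨_, ⟨?_, hz⟩, n, rfl⟩
      rw [← hn, Function.iterate_succ_apply']

theorem below_comparable (h : x ∈ below π y) (h' : x ∈ below π z) :
    y ∈ below π z ∨ z ∈ below π y := by
  obtain ⟨a, rfl⟩ := h
  obtain ⟨b, rfl⟩ := h'
  rcases le_total a b with hab | hab
  · left
    exact ⟨b - a, by rw [← Function.iterate_add_apply, Nat.sub_add_cancel hab]⟩
  · right
    exact ⟨a - b, by rw [← Function.iterate_add_apply, Nat.sub_add_cancel hab]⟩

theorem iterate_fixed (h : π x = x) (n : ℕ) : π^[n] x = x := Function.iterate_fixed h n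

theorem parent_ne_of_mem_below (hv : π v ≠ v) (h : x ∈ below π v) : π x ≠ x := by
  rintro hx
  obtain ⟨n, rfl⟩ := h
  rw [iterate_fixed hx] at hv
  exact hv hx

theorem parent_ne_of_mem_kids (h : y ∈ kids π v) : π y ≠ y := by
  rw [h.1]; exact h.2.symm

theorem notMem_below_kid (hac : Acyclic π) (h : y ∈ kids π v) : v ∉ below π y := by
  rintro ⟨n, hn⟩
  have h1 : π v = v := hac v n (by rw [Function.iterate_succ_apply', hn, h.1])
  rw [iterate_fixed h1] at hn
  exact h.2 hn.symm

theorem disjoint_below_kids (hac : Acyclic π) (hy : y ∈ kids π v) (hz : z ∈ kids π v)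
    (hne : y ≠ z) : Disjoint (below π y) (below π z) := by
  rw [Set.disjoint_left]
  intro x h1 h2
  rcases below_comparable h1 h2 with h | h
  · have := parent_mem_below h hne
    rw [hy.1] at this
    exact notMem_below_kid hac hz this
  · have := parent_mem_below h hne.symm
    rw [hz.1] at this
    exact notMem_below_kid hac hy this

theorem semiconj_inv (hg : Function.Semiconj g π π) : Function.Semiconj (g⁻¹ : Equiv.Perm V) π π :=
  fun x => by
    apply g.injective
    rw [hg (g⁻¹ x)]
    simp

theorem map_mem_below (hg : Function.Semiconj g π π) (h : x ∈ below π v) :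
    g x ∈ below π (g v) := by
  obtain ⟨n, rfl⟩ := h
  exact ⟨n, ((hg.iterate_right n) x).symm⟩

theorem map_mem_below_iff (hg : Function.Semiconj g π π) :
    g x ∈ below π (g v) ↔ x ∈ below π v := by
  refine ⟨fun h => ?_, map_mem_below hg⟩
  simpa using map_mem_below (semiconj_inv hg) h

theorem image_below (hg : Function.Semiconj g π π) : g '' below π v = below π (g v) := by
  ext x
  refine ⟨?_, fun h => ⟨g⁻¹ x, ?_, by simp⟩⟩
  · rintro ⟨y, hy, rfl⟩
    exact map_mem_below hg hy
  · rw [← map_mem_below_iff hg]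
    simpa using h

theorem map_mem_kids (hg : Function.Semiconj g π π) (h : y ∈ kids π v) : g y ∈ kids π (g v) :=
  ⟨by rw [← hg y, h.1], fun e => h.2 (g.injective e)⟩

theorem finite_below_map (hg : Function.Semiconj g π π) :
    (below π (g v)).Finite ↔ (below π v).Finite := by
  rw [← image_below hg, Set.finite_image_iff g.injective.injOn]

theorem ncard_below_map (hg : Function.Semiconj g π π) :
    (below π (g v)).ncard = (below π v).ncard := by
  rw [← image_below hg, Set.ncard_image_of_injective _ g.injective]

/-- An automorphism `g` carrying a vertex `y` to a sibling `z` gives rise to an automorphism that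
exchanges the branches at `y` and `z` and fixes everything else. -/
theorem exists_swap (hac : Acyclic π) (hg : Function.Semiconj g π π) (hy : y ∈ kids π v)
    (hz : z ∈ kids π v) (hne : y ≠ z) (hgy : g y = z) :
    ∃ h : Equiv.Perm V, Function.Semiconj h π π ∧ h y = z ∧
      ∀ x, x ∉ below π y → x ∉ below π z → h x = x := by
  classical
  have hdisj := disjoint_below_kids hac hy hz hne
  rw [Set.disjoint_left] at hdisj
  have hmap : ∀ {x}, x ∈ below π y → g x ∈ below π z := fun {x} hx => by
    rw [← hgy]; exact map_mem_below hg hx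
  have hinv : ∀ {x}, x ∈ below π z → g⁻¹ x ∈ below π y := fun {x} hx => by
    have := map_mem_below (semiconj_inv hg) hx
    rw [← hgy] at this
    simpa using this
  set f : V → V := fun x =>
    if x ∈ below π y then g x else if x ∈ below π z then g⁻¹ x else x with hf
  have f1 : ∀ {x}, x ∈ below π y → f x = g x := fun hx => if_pos hx
  have f2 : ∀ {x}, x ∈ below π z → f x = g⁻¹ x := fun {x} hx => by
    have : x ∉ below π y := fun h => hdisj h hx
    simp only [hf, if_neg this, if_pos hx]
  have f3 : ∀ {x}, x ∉ below π y → x ∉ below π z → f x = x := fun h1 h2 => by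
    simp only [hf, if_neg h1, if_neg h2]
  have hfi : Function.Involutive f := by
    intro x
    by_cases h1 : x ∈ below π y
    · rw [f1 h1, f2 (hmap h1)]
      simp
    · by_cases h2 : x ∈ below π z
      · rw [f2 h2, f1 (hinv h2)]
        simp
      · rw [f3 h1 h2, f3 h1 h2]
  have fv : f v = v := f3 (notMem_below_kid hac hy) (notMem_below_kid hac hz)
  refine ⟨hfi.toPerm, fun x => ?_, ?_, fun x h1 h2 => f3 h1 h2⟩
  · change f (π x) = π (f x)
    by_cases h1 : x ∈ below π y
    · by_cases hxy : x = y
      · rw [hxy, hy.1, fv, f1 (self_mem_below y), hgy, hz.1]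
      · rw [f1 h1, f1 (parent_mem_below h1 hxy), hg x]
    · by_cases h2 : x ∈ below π z
      · by_cases hxz : x = z
        · rw [hxz, hz.1, fv, f2 (self_mem_below z), ← hgy]
          simp [hy.1]
        · rw [f2 h2, f2 (parent_mem_below h2 hxz), semiconj_inv hg x]
      · rw [f3 h1 h2, f3 (fun h => h1 (mem_below_of_parent h))
          (fun h => h2 (mem_below_of_parent h))]
  · change f y = z
    rw [f1 (self_mem_below y), hgy]

/-- The hypotheses of the counting argument: `π` is a parent map all of whose nonidentity
automorphisms move at least `m` vertices, where `N ^ 2 ≤ 2 ^ m`, and a vertex other than the root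
has fewer than `N` children. -/
structure Branching (π : V → V) (m N : ℕ) : Prop where
  acyclic : Acyclic π
  motion : ∀ g : Equiv.Perm V, Function.Semiconj g π π → g ≠ 1 → {x | g x ≠ x}.Finite →
    m ≤ {x | g x ≠ x}.ncard
  sq_le : N ^ 2 ≤ 2 ^ m
  finite_kids : ∀ v, (kids π v).Finite
  ncard_kids_lt : ∀ v, π v ≠ v → (kids π v).ncard < N

variable {m N : ℕ}

/-- A finite branch that an automorphism carries to a sibling has at least `m / 2` vertices. -/
theorem Branching.le_two_mul_ncard (hB : Branching π m N) (hg : Function.Semiconj g π π)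
    (hy : y ∈ kids π v) (hz : z ∈ kids π v) (hne : y ≠ z) (hgy : g y = z)
    (hfin : (below π y).Finite) : m ≤ 2 * (below π y).ncard := by
  obtain ⟨h, hh, hyz, hfix⟩ := exists_swap hB.acyclic hg hy hz hne hgy
  have hfz : (below π z).Finite := by rw [← hgy, finite_below_map hg]; exact hfin
  have hsub : {x | h x ≠ x} ⊆ below π y ∪ below π z := by
    intro x hx
    by_contra hcon
    rw [Set.mem_union, not_or] at hcon
    exact hx (hfix x hcon.1 hcon.2)
  have hfu := hfin.union hfz
  have h1 : h ≠ 1 := by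
    rintro rfl
    exact hne hyz
  calc m ≤ {x | h x ≠ x}.ncard := hB.motion h hh h1 (hfu.subset hsub)
    _ ≤ (below π y ∪ below π z).ncard := Set.ncard_le_ncard hsub hfu
    _ ≤ (below π y).ncard + (below π z).ncard := Set.ncard_union_le _ _
    _ = 2 * (below π y).ncard := by rw [← hgy, ncard_below_map hg]; ring

/-- Two coloured branches, given as a set of vertices with the top vertex of the branch, are
equivalent if an automorphism of `π` carries one to the other. -/
def branchSetoid (π : V → V) : Setoid (Set V × V) where
  r a b := ∃ g : Equiv.Perm V, Function.Semiconj g π π ∧ g a.2 = b.2 ∧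
    ∀ y ∈ below π a.2, (y ∈ a.1 ↔ g y ∈ b.1)
  iseqv :=
    { refl := fun a => ⟨1, fun _ => rfl, rfl, fun _ _ => Iff.rfl⟩
      symm := by
        rintro ⟨A, a⟩ ⟨B, b⟩ ⟨g, hg, rfl, h⟩
        refine ⟨g⁻¹, semiconj_inv hg, by simp, fun y hy => ?_⟩
        have hy' : g⁻¹ y ∈ below π a := by
          have := map_mem_below (semiconj_inv hg) hy
          simpa using this
        simpa using (h _ hy').symm
      trans := by
        rintro ⟨A, a⟩ ⟨B, b⟩ ⟨C, c⟩ ⟨g, hg, rfl, h⟩ ⟨k, hk, rfl, h'⟩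
        refine ⟨k * g, fun x => ?_, rfl, fun y hy => ?_⟩
        · simp only [Equiv.Perm.mul_apply]
          rw [hg x, hk]
        · exact (h y hy).trans (h' _ (map_mem_below hg hy)) }

/-- The equivalence class of the branch at `v`, coloured by `S`. -/
def cls (π : V → V) (S : Set V) (v : V) : Quotient (branchSetoid π) := Quotient.mk _ (S, v)

theorem cls_eq_iff : cls π S v = cls π S' w ↔ ∃ g : Equiv.Perm V, Function.Semiconj g π π ∧
    g v = w ∧ ∀ y ∈ below π v, (y ∈ S ↔ g y ∈ S') :=
  Quotient.eq (r := branchSetoid π)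

theorem cls_congr (h : ∀ y ∈ below π v, (y ∈ S ↔ y ∈ S')) : cls π S v = cls π S' v :=
  cls_eq_iff.2 ⟨1, fun _ => rfl, rfl, h⟩

/-- The colouring `S` separates the children of `x`: no two of the finite branches at children
of `x` are equivalent. -/
def SeparatesAt (π : V → V) (S : Set V) (x : V) : Prop :=
  ∀ y ∈ kids π x, ∀ z ∈ kids π x, (below π y).Finite → (below π z).Finite →
    cls π S y = cls π S z → y = z

/-- The colouring `S` separates the children of every vertex of the branch at `v`. -/
def Good (π : V → V) (S : Set V) (v : V) : Prop := ∀ x ∈ below π v, SeparatesAt π S x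

theorem SeparatesAt.congr (h : SeparatesAt π S x)
    (hSS : ∀ y ∈ kids π x, (below π y).Finite → ∀ t ∈ below π y, (t ∈ S ↔ t ∈ S')) :
    SeparatesAt π S' x := by
  intro y hy z hz hfy hfz he
  refine h y hy z hz hfy hfz ?_
  rw [cls_congr (hSS y hy hfy), cls_congr (hSS z hz hfz), he]

theorem Good.congr (h : Good π S v) (hSS : ∀ y ∈ below π v, (y ∈ S ↔ y ∈ S')) :
    Good π S' v := fun x hx => (h x hx).congr fun _ hy _ t ht =>
  hSS t (mem_below_trans (mem_below_trans ht (mem_below_of_mem_kids hy)) hx)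

theorem cls_image (hg : Function.Semiconj g π π) : cls π (g '' S) (g v) = cls π S v := by
  refine (cls_eq_iff.2 ⟨g, hg, rfl, fun y _ => ?_⟩).symm
  rw [g.injective.mem_set_image]

theorem SeparatesAt.image (hg : Function.Semiconj g π π) (h : SeparatesAt π S x) :
    SeparatesAt π (g '' S) (g x) := by
  intro y hy z hz hfy hfz he
  have key : ∀ {y}, y ∈ kids π (g x) → ∃ y' ∈ kids π x, g y' = y := fun {y} hy =>
    ⟨g⁻¹ y, by simpa using map_mem_kids (semiconj_inv hg) hy, by simp⟩
  obtain ⟨y, hy', rfl⟩ := key hy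
  obtain ⟨z, hz', rfl⟩ := key hz
  rw [cls_image hg, cls_image hg] at he
  rw [finite_below_map hg] at hfy hfz
  rw [h y hy' z hz' hfy hfz he]

theorem Good.image (hg : Function.Semiconj g π π) (h : Good π S v) : Good π (g '' S) (g v) := by
  intro x hx
  have hx' : g⁻¹ x ∈ below π v := by simpa using map_mem_below (semiconj_inv hg) hx
  simpa using (h _ hx').image hg

theorem Good.of_kids (hk : ∀ y ∈ kids π v, Good π S y) (hv : SeparatesAt π S v) : Good π S v := by
  intro x hx
  rcases eq_or_exists_kid hx with rfl | ⟨y, hy, hxy⟩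
  · exact hv
  · exact hk y hy x hxy

end Branches

/-! ### Counting inequivalent colourings of finite branches -/

section Counting

variable {V : Type*} {π : V → V} {g : Equiv.Perm V} {x y z v w : V} {S S' : Set V} {m N : ℕ}

/-- The branch at `v` is `N`-rich if it has `N` pairwise inequivalent good colourings. -/
def Rich (π : V → V) (N : ℕ) (v : V) : Prop :=
  ∃ A : Finset (Quotient (branchSetoid π)), A.card = N ∧
    ∀ a ∈ A, ∃ S, Good π S v ∧ cls π S v = a

/-- Fewer than `N` siblings of `y`, coloured arbitrarily, leave a good colouring of the branch at
`y` that is inequivalent to all of them: either the branch is rich, or it is too small to be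
isomorphic to a branch at a sibling. -/
theorem Branching.exists_good_avoiding (hB : Branching π m N) (hy : y ∈ kids π v)
    (hfin : (below π y).Finite) (hgood : ∃ S, Good π S y)
    (hrich : m ≤ 2 * (below π y).ncard → Rich π N y) (U : Finset V)
    (hU : ∀ z ∈ U, z ∈ kids π v ∧ z ≠ y) (hcard : U.card < N) (S' : Set V) :
    ∃ S, Good π S y ∧ ∀ z ∈ U, cls π S y ≠ cls π S' z := by
  classical
  by_cases h : m ≤ 2 * (below π y).ncard
  · obtain ⟨A, hA, hAS⟩ := hrich h
    obtain ⟨a, ha, haU⟩ := Finset.exists_mem_notMem_of_card_lt_card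
      (s := U.image (fun z => cls π S' z)) (t := A)
      (by rw [hA]; exact Finset.card_image_le.trans_lt hcard)
    obtain ⟨S, hS, rfl⟩ := hAS a ha
    exact ⟨S, hS, fun z hz he => haU (Finset.mem_image.2 ⟨z, hz, he.symm⟩)⟩
  · obtain ⟨S, hS⟩ := hgood
    refine ⟨S, hS, fun z hz he => h ?_⟩
    obtain ⟨g, hg, hgy, -⟩ := cls_eq_iff.1 he
    exact hB.le_two_mul_ncard hg hy (hU z hz).1 (hU z hz).2.symm hgy hfin

/-- Greedy recolouring of the branches at a set `F` of siblings. -/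
theorem Branching.exists_recolouring (hB : Branching π m N) (U F : Finset V) (hFU : F ⊆ U)
    (hU : ∀ z ∈ U, z ∈ kids π v) (hcard : U.card ≤ N)
    (hfin : ∀ y ∈ F, (below π y).Finite) (hgood : ∀ y ∈ F, ∃ S, Good π S y)
    (hrich : ∀ y ∈ F, m ≤ 2 * (below π y).ncard → Rich π N y) (S₀ : Set V) :
    ∃ S, (∀ x, (∀ y ∈ F, x ∉ below π y) → (x ∈ S ↔ x ∈ S₀)) ∧ (∀ y ∈ F, Good π S y) ∧
      ∀ y ∈ F, ∀ z ∈ U, z ≠ y → cls π S y ≠ cls π S z := by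
  classical
  induction F using Finset.induction_on with
  | empty => exact ⟨S₀, by simp, by simp, by simp⟩
  | insert y F hyF ih =>
    have hyU : y ∈ U := hFU (Finset.mem_insert_self y F)
    have hFU' : F ⊆ U := (Finset.subset_insert y F).trans hFU
    obtain ⟨S, hS0, hSg, hSne⟩ := ih hFU' (fun z hz => hfin z (Finset.mem_insert_of_mem hz))
      (fun z hz => hgood z (Finset.mem_insert_of_mem hz))
      (fun z hz => hrich z (Finset.mem_insert_of_mem hz))
    obtain ⟨S₁, hS₁g, hS₁ne⟩ := hB.exists_good_avoiding (hU y hyU)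
      (hfin y (Finset.mem_insert_self y F)) (hgood y (Finset.mem_insert_self y F))
      (hrich y (Finset.mem_insert_self y F)) (U.erase y)
      (fun z hz => ⟨hU z (Finset.mem_of_mem_erase hz), Finset.ne_of_mem_erase hz⟩)
      ((Finset.card_erase_lt_of_mem hyU).trans_le hcard) S
    set S₂ : Set V := {x | if x ∈ below π y then x ∈ S₁ else x ∈ S} with hS₂
    have e1 : ∀ x ∈ below π y, (x ∈ S₁ ↔ x ∈ S₂) := fun x hx => by
      simp only [hS₂, Set.mem_ofPred_eq, if_pos hx]
    have e2 : ∀ x, x ∉ below π y → (x ∈ S ↔ x ∈ S₂) := fun x hx => by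
      simp only [hS₂, Set.mem_ofPred_eq, if_neg hx]
    have e3 : ∀ z ∈ U, z ≠ y → ∀ x ∈ below π z, (x ∈ S ↔ x ∈ S₂) := fun z hz hne x hx =>
      e2 x fun hxy => (Set.disjoint_left.1 (disjoint_below_kids hB.acyclic (hU z hz) (hU y hyU)
        hne)) hx hxy
    refine ⟨S₂, fun x hx => ?_, fun z hz => ?_, fun z hz t ht hne => ?_⟩
    · rw [← e2 x (hx y (Finset.mem_insert_self y F))]
      exact hS0 x fun z hz => hx z (Finset.mem_insert_of_mem hz)
    · rcases Finset.mem_insert.1 hz with rfl | hz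
      · exact hS₁g.congr e1
      · exact (hSg z hz).congr (e3 z (hFU' hz) (fun h => hyF (h ▸ hz)))
    · rcases Finset.mem_insert.1 hz with rfl | hzF
      · rw [← cls_congr e1, ← cls_congr (e3 t ht hne)]
        exact hS₁ne t (Finset.mem_erase.2 ⟨hne, ht⟩)
      · have hzy : z ≠ y := fun h => hyF (h ▸ hzF)
        by_cases hty : t = y
        · subst hty
          rw [← cls_congr e1, ← cls_congr (e3 z (hFU' hzF) hzy)]
          exact (hS₁ne z (Finset.mem_erase.2 ⟨hzy, hFU' hzF⟩)).symm
        · rw [← cls_congr (e3 t ht hty), ← cls_congr (e3 z (hFU' hzF) hzy)]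
          exact hSne z hzF t ht hne

/-- A branch that is large enough, but such that the branches at the children of its top vertex
are not, has no symmetries: all its colourings are good and pairwise inequivalent. -/
theorem Branching.rich_of_small_kids (hB : Branching π m N)
    (hfin : (below π v).Finite) (hm : m ≤ 2 * (below π v).ncard)
    (hk : ∀ y ∈ kids π v, ¬ m ≤ 2 * (below π y).ncard) : Rich π N v := by
  classical
  have hsmall : ∀ y ∈ below π v, y ≠ v → ¬ m ≤ 2 * (below π y).ncard := by
    intro y hy hne
    obtain ⟨z, hz, hyz⟩ := (eq_or_exists_kid hy).resolve_left hne
    have := Set.ncard_le_ncard (below_subset hyz)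
      (hfin.subset (below_subset (mem_below_of_mem_kids hz)))
    have := hk z hz
    omega
  have hsib : ∀ x ∈ below π v, ∀ y ∈ kids π x, ∀ z ∈ kids π x, ∀ g : Equiv.Perm V,
      Function.Semiconj g π π → g y = z → y = z := by
    intro x hx y hy z hz g hg hgy
    by_contra hne
    have hyv : y ∈ below π v := mem_below_trans (mem_below_of_mem_kids hy) hx
    refine hsmall y hyv ?_
      (hB.le_two_mul_ncard hg hy hz hne hgy (hfin.subset (below_subset hyv)))
    rintro rfl
    exact notMem_below_kid hB.acyclic hy hx
  have hgood : ∀ S, Good π S v := by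
    intro S x hx y hy z hz _ _ he
    obtain ⟨g, hg, hgy, -⟩ := cls_eq_iff.1 he
    exact hsib x hx y hy z hz g hg hgy
  have hfix : ∀ g : Equiv.Perm V, Function.Semiconj g π π → g v = v →
      ∀ x ∈ below π v, g x = x := by
    rintro g hg hgv x ⟨n, hn⟩
    induction n generalizing x with
    | zero => rw [show x = v from hn, hgv]
    | succ n ih =>
      have h1 : g (π x) = π x := ih (π x) hn
      by_cases hxv : x = v
      · rw [hxv, hgv]
      by_cases hx : π x = x
      · rwa [hx] at h1
      · have hk' : x ∈ kids π (π x) := ⟨rfl, fun h => hx h.symm⟩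
        have := map_mem_kids hg hk'
        rw [h1] at this
        exact (hsib (π x) ⟨n, hn⟩ x hk' _ this g hg rfl).symm
  set D := hfin.toFinset with hD
  have hinj : Set.InjOn (fun S : Finset V => cls π (S : Set V) v) (D.powerset : Set (Finset V)) := by
    intro S hS T hT he
    obtain ⟨g, hg, hgv, h⟩ := cls_eq_iff.1 he
    simp only [Finset.coe_powerset, Set.mem_preimage, Set.mem_powerset_iff, Finset.coe_subset,
      hD] at hS hT
    ext x
    constructor
    · intro hx
      have hxD : x ∈ below π v := hfin.mem_toFinset.1 (hS hx)
      have := (h x hxD).1 hx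
      rwa [hfix g hg hgv x hxD] at this
    · intro hx
      have hxD : x ∈ below π v := hfin.mem_toFinset.1 (hT hx)
      refine (h x hxD).2 ?_
      rwa [hfix g hg hgv x hxD]
  have hcard : N ≤ (D.powerset.image (fun S : Finset V => cls π (S : Set V) v)).card := by
    rw [Finset.card_image_of_injOn hinj, Finset.card_powerset, hD,
      ← Set.ncard_eq_toFinset_card _ hfin]
    have : N ^ 2 ≤ (2 ^ (below π v).ncard) ^ 2 := by
      refine hB.sq_le.trans ?_
      rw [← pow_mul, mul_comm]
      exact Nat.pow_le_pow_right (by norm_num) hm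
    exact (Nat.pow_le_pow_iff_left (by norm_num)).1 this
  obtain ⟨A, hA, hAc⟩ := Finset.exists_subset_card_eq hcard
  refine ⟨A, hAc, fun a ha => ?_⟩
  obtain ⟨S, -, rfl⟩ := Finset.mem_image.1 (hA ha)
  exact ⟨S, hgood _, rfl⟩

theorem le_choose {n k : ℕ} (h1 : 1 ≤ k) (h2 : k < n) : n ≤ n.choose k := by
  induction n generalizing k with
  | zero => omega
  | succ n ih =>
    obtain ⟨k, rfl⟩ : ∃ j, k = j + 1 := ⟨k - 1, by omega⟩
    rcases Nat.lt_or_ge (k + 1) n with h | h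
    · rw [Nat.choose_succ_succ']
      have := ih (k := k + 1) (by omega) h
      have := Nat.choose_pos (n := n) (k := k) (by omega)
      omega
    · obtain rfl : n = k + 1 := by omega
      rw [Nat.choose_succ_self_right]

/-- If the branch at a child `y` of `v` is rich, then so is the branch at `v`. The `k` siblings of
`y` isomorphic to it, with `k < N`, can receive any `k`-element subset of the `N` classes available
for `y`, and this subset is an invariant of the coloured branch at `v`; finally
`N ≤ N.choose k`. -/
theorem Branching.rich_of_rich_kid (hB : Branching π m N) (hv : π v ≠ v)
    (hfin : (below π v).Finite) (hgood : ∀ z ∈ kids π v, ∃ S, Good π S z)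
    (hrich : ∀ z ∈ kids π v, m ≤ 2 * (below π z).ncard → Rich π N z)
    (hy : y ∈ kids π v) (hR : Rich π N y) : Rich π N v := by
  classical
  obtain ⟨A, hAc, hA⟩ := hR
  choose! col hcol hcls using hA
  set U := (hB.finite_kids v).toFinset with hUdef
  have hU : ∀ z, z ∈ U ↔ z ∈ kids π v := fun z => Set.Finite.mem_toFinset _
  have hUN : U.card < N := by
    rw [hUdef, ← Set.ncard_eq_toFinset_card _ (hB.finite_kids v)]; exact hB.ncard_kids_lt v hv
  set X := U.filter (fun z => ∃ g : Equiv.Perm V, Function.Semiconj g π π ∧ g y = z) with hX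
  -- `X` is the set of the siblings of `y`, including `y`, with branches isomorphic to that at `y`.
  have hXU : X ⊆ U := Finset.filter_subset _ _
  have hyX : y ∈ X := Finset.mem_filter.2 ⟨(hU y).2 hy, 1, fun _ => rfl, rfl⟩
  have hg' : ∀ z ∈ X, ∃ g : Equiv.Perm V, Function.Semiconj g π π ∧ g y = z := fun z hz =>
    (Finset.mem_filter.1 hz).2
  choose! t ht hty using hg'
  have hk1 : 1 ≤ X.card := Finset.card_pos.2 ⟨y, hyX⟩
  have hk2 : X.card < N := (Finset.card_le_card hXU).trans_lt hUN
  have hfink : ∀ z ∈ U, (below π z).Finite := fun z hz =>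
    hfin.subset (below_subset (mem_below_of_mem_kids ((hU z).1 hz)))
  -- The colouring of the branch at `v` realizing a prescribed set of classes.
  have main : ∀ J ∈ A.powersetCard X.card, ∃ S, Good π S v ∧
      ∀ a ∈ A, (a ∈ J ↔ ∃ z ∈ kids π v, cls π S z = a) := by
    intro J hJ
    obtain ⟨hJA, hJc⟩ := Finset.mem_powersetCard.1 hJ
    have e : X ≃ J := Finset.equivOfCardEq hJc.symm
    set S₀ : Set V := {x | ∃ z : X, x ∈ below π z ∧ x ∈ (t z) '' (col (e z))} with hS₀
    have hS₀mem : ∀ z : X, ∀ x ∈ below π (z : V), (x ∈ (t z) '' (col (e z)) ↔ x ∈ S₀) := by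
      intro z x hx
      refine ⟨fun h => ⟨z, hx, h⟩, ?_⟩
      rintro ⟨z', hx', h⟩
      have : z' = z := by
        by_contra hne
        refine Set.disjoint_left.1 (disjoint_below_kids hB.acyclic
          ((hU _).1 (hXU z'.2)) ((hU _).1 (hXU z.2)) (fun h => hne (Subtype.ext h))) hx' hx
      rwa [this] at h
    obtain ⟨S, hS1, hS2, hS3⟩ := hB.exists_recolouring (v := v) U (U \ X) Finset.sdiff_subset
      (fun z hz => (hU z).1 hz) hUN.le (fun z hz => hfink z (Finset.mem_sdiff.1 hz).1)
      (fun z hz => hgood z ((hU z).1 (Finset.mem_sdiff.1 hz).1))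
      (fun z hz => hrich z ((hU z).1 (Finset.mem_sdiff.1 hz).1)) S₀
    have hSX : ∀ z : X, ∀ x ∈ below π (z : V), (x ∈ (t z) '' (col (e z)) ↔ x ∈ S) := by
      intro z x hx
      rw [hS₀mem z x hx, hS1 x]
      intro z' hz' hx'
      obtain ⟨h1, h2⟩ := Finset.mem_sdiff.1 hz'
      exact Set.disjoint_left.1 (disjoint_below_kids hB.acyclic
          ((hU _).1 h1) ((hU _).1 (hXU z.2)) (fun h => h2 (h ▸ z.2))) hx' hx
    have hSXc : ∀ z : X, cls π S z = (e z : Quotient (branchSetoid π)) := by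
      intro z
      rw [← cls_congr (hSX z)]
      have h1 := cls_image (S := col (e z)) (v := y) (ht z z.2)
      rw [hty z z.2] at h1
      rw [h1, hcls _ (hJA (e z).2)]
    have hSXg : ∀ z : X, Good π S z := by
      intro z
      have h1 := (hcol (e z) (hJA (e z).2)).image (ht z z.2)
      rw [hty z z.2] at h1
      exact h1.congr (hSX z)
    refine ⟨S, Good.of_kids (fun z hz => ?_) ?_, fun a ha => ?_⟩
    · by_cases hzX : z ∈ X
      · exact hSXg ⟨z, hzX⟩
      · exact hS2 z (Finset.mem_sdiff.2 ⟨(hU z).2 hz, hzX⟩)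
    · intro z hz z' hz' _ _ he
      by_contra hne
      by_cases hzX : z ∈ X
      · by_cases hzX' : z' ∈ X
        · have h1 := hSXc ⟨z, hzX⟩
          have h2 := hSXc ⟨z', hzX'⟩
          simp only at h1 h2
          rw [h1, h2] at he
          have := e.injective (Subtype.ext he)
          exact hne (congrArg Subtype.val this)
        · exact hS3 z' (Finset.mem_sdiff.2 ⟨(hU z').2 hz', hzX'⟩) z ((hU z).2 hz) hne he.symm
      · exact hS3 z (Finset.mem_sdiff.2 ⟨(hU z).2 hz, hzX⟩) z' ((hU z').2 hz')
          (fun h => hne h.symm) he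
    · constructor
      · intro haJ
        refine ⟨e.symm ⟨a, haJ⟩, (hU _).1 (hXU (e.symm ⟨a, haJ⟩).2), ?_⟩
        rw [hSXc, e.apply_symm_apply]
      · rintro ⟨z, hz, hza⟩
        have hzX : z ∈ X := by
          rw [← hcls a ha] at hza
          obtain ⟨g, hg, hgz, -⟩ := cls_eq_iff.1 hza.symm
          exact Finset.mem_filter.2 ⟨(hU z).2 hz, g, hg, hgz⟩
        have h1 := hSXc ⟨z, hzX⟩
        simp only at h1
        rw [← hza, h1]
        exact (e ⟨z, hzX⟩).2
  choose! F hF1 hF2 using main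
  have hinj : Set.InjOn (fun J => cls π (F J) v)
      (A.powersetCard X.card : Set (Finset (Quotient (branchSetoid π)))) := by
    have key : ∀ J ∈ A.powersetCard X.card, ∀ J' ∈ A.powersetCard X.card,
        cls π (F J) v = cls π (F J') v → J ⊆ J' := by
      intro J hJ J' hJ' he a ha
      have haA := (Finset.mem_powersetCard.1 hJ).1 ha
      obtain ⟨z, hz, hza⟩ := (hF2 J hJ a haA).1 ha
      obtain ⟨g, hg, hgv, h⟩ := cls_eq_iff.1 he
      refine (hF2 J' hJ' a haA).2 ⟨g z, ?_, ?_⟩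
      · have := map_mem_kids hg hz
        rwa [hgv] at this
      · rw [← hza]
        exact (cls_eq_iff.2 ⟨g, hg, rfl, fun x hx =>
          h x (mem_below_trans hx (mem_below_of_mem_kids hz))⟩).symm
    intro J hJ J' hJ' he
    exact (key J hJ J' hJ' he).antisymm (key J' hJ' J hJ he.symm)
  have hcard : N ≤ ((A.powersetCard X.card).image (fun J => cls π (F J) v)).card := by
    rw [Finset.card_image_of_injOn hinj, Finset.card_powersetCard, hAc]
    exact le_choose hk1 hk2
  obtain ⟨B, hB1, hB2⟩ := Finset.exists_subset_card_eq hcard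
  refine ⟨B, hB2, fun b hb => ?_⟩
  obtain ⟨J, hJ, rfl⟩ := Finset.mem_image.1 (hB1 hb)
  exact ⟨F J, hF1 J hJ, rfl⟩

/-- Every finite branch has a good colouring, and it has `N` inequivalent ones if it has at least
`m / 2` vertices. -/
theorem Branching.exists_good_and_rich (hB : Branching π m N) (hv : π v ≠ v)
    (hfin : (below π v).Finite) :
    (∃ S, Good π S v) ∧ (m ≤ 2 * (below π v).ncard → Rich π N v) := by
  classical
  induction hn : (below π v).ncard using Nat.strong_induction_on generalizing v with
  | _ n ih =>
    subst hn
    have hk : ∀ y ∈ kids π v, (∃ S, Good π S y) ∧ (m ≤ 2 * (below π y).ncard → Rich π N y) := by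
      intro y hy
      have hsub := below_subset (mem_below_of_mem_kids hy)
      refine ih _ (Set.ncard_lt_ncard ⟨hsub, fun h => ?_⟩ hfin) (parent_ne_of_mem_kids hy)
        (hfin.subset hsub) rfl
      exact notMem_below_kid hB.acyclic hy (h (self_mem_below v))
    refine ⟨?_, fun hm => ?_⟩
    · have hU : ∀ z, z ∈ (hB.finite_kids v).toFinset ↔ z ∈ kids π v := fun z =>
        Set.Finite.mem_toFinset _
      obtain ⟨S, -, hS2, hS3⟩ := hB.exists_recolouring (v := v) (hB.finite_kids v).toFinset
        (hB.finite_kids v).toFinset subset_rfl (fun z hz => (hU z).1 hz)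
        (by
          rw [← Set.ncard_eq_toFinset_card _ (hB.finite_kids v)]
          exact (hB.ncard_kids_lt v hv).le)
        (fun z hz => hfin.subset (below_subset (mem_below_of_mem_kids ((hU z).1 hz))))
        (fun z hz => (hk z ((hU z).1 hz)).1) (fun z hz => (hk z ((hU z).1 hz)).2) ∅
      refine ⟨S, Good.of_kids (fun z hz => hS2 z ((hU z).2 hz)) fun z hz z' hz' _ _ he => ?_⟩
      by_contra hne
      exact hS3 z ((hU z).2 hz) z' ((hU z').2 hz') (fun h => hne h.symm) he
    · by_cases h : ∃ y ∈ kids π v, m ≤ 2 * (below π y).ncard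
      · obtain ⟨y, hy, hym⟩ := h
        exact hB.rich_of_rich_kid hv hfin (fun z hz => (hk z hz).1) (fun z hz => (hk z hz).2)
          hy ((hk y hy).2 hym)
      · push Not at h
        exact hB.rich_of_small_kids hfin hm fun y hy => not_le.2 (h y hy)

/-- The recolouring of the branches at a set `F` of children of `v`, with the conclusion in the
form used below: `F` are the children to recolour, and at most one finite branch at a child
outside `F` keeps its colours. -/
theorem Branching.exists_separating (hB : Branching π m N) (hN : (kids π v).ncard ≤ N)
    (F : Set V) (hF : ∀ y ∈ F, y ∈ kids π v ∧ (below π y).Finite)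
    (hF' : ∀ y ∈ kids π v, ∀ z ∈ kids π v, y ∉ F → z ∉ F → (below π y).Finite →
      (below π z).Finite → y = z) (S₀ : Set V) :
    ∃ S, (∀ x, (∀ y ∈ F, x ∉ below π y) → (x ∈ S ↔ x ∈ S₀)) ∧ (∀ y ∈ F, Good π S y) ∧
      SeparatesAt π S v := by
  classical
  have hFf : F.Finite := (hB.finite_kids v).subset fun y hy => (hF y hy).1
  have hU : ∀ z, z ∈ (hB.finite_kids v).toFinset ↔ z ∈ kids π v := fun z =>
    Set.Finite.mem_toFinset _
  have hFm : ∀ z, z ∈ hFf.toFinset ↔ z ∈ F := fun z => Set.Finite.mem_toFinset _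
  have hGR := fun y (hy : y ∈ F) =>
    hB.exists_good_and_rich (parent_ne_of_mem_kids (hF y hy).1) (hF y hy).2
  obtain ⟨S, hS1, hS2, hS3⟩ := hB.exists_recolouring (v := v) (hB.finite_kids v).toFinset
    hFf.toFinset (fun y hy => (hU y).2 (hF y ((hFm y).1 hy)).1) (fun z hz => (hU z).1 hz)
    (by rwa [← Set.ncard_eq_toFinset_card _ (hB.finite_kids v)])
    (fun z hz => (hF z ((hFm z).1 hz)).2)
    (fun z hz => (hGR z ((hFm z).1 hz)).1) (fun z hz => (hGR z ((hFm z).1 hz)).2) S₀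
  refine ⟨S, fun x hx => hS1 x fun y hy => hx y ((hFm y).1 hy),
    fun y hy => hS2 y ((hFm y).2 hy), fun y hy z hz hfy hfz he => ?_⟩
  by_contra hne
  by_cases hyF : y ∈ F
  · exact hS3 y ((hFm y).2 hyF) z ((hU z).2 hz) (fun h => hne h.symm) he
  · by_cases hzF : z ∈ F
    · exact hS3 z ((hFm z).2 hzF) y ((hU y).2 hy) hne he.symm
    · exact hne (hF' y hy z hz hyF hzF hfy hfz)

/-- An automorphism preserving a colouring that separates the children of every vertex fixes all
vertices, provided that it fixes all vertices with infinite branches and that every vertex has a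
fixed ancestor. -/
theorem eq_one_of_separates (hg : Function.Semiconj g π π) (hS : ∀ x, SeparatesAt π S x)
    (hgS : ∀ x, g x ∈ S ↔ x ∈ S) (hinf : ∀ x, ¬ (below π x).Finite → g x = x)
    (hanc : ∀ x, ∃ n, g (π^[n] x) = π^[n] x) : g = 1 := by
  ext x
  obtain ⟨n, hn⟩ := hanc x
  induction n generalizing x with
  | zero => exact hn
  | succ n ih =>
    have h1 : g (π x) = π x := ih (π x) hn
    by_cases hx : π x = x
    · rw [hx] at h1
      exact h1
    by_cases hfin : (below π x).Finite
    · have hk : x ∈ kids π (π x) := ⟨rfl, fun h => hx h.symm⟩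
      have hk' := map_mem_kids hg hk
      rw [h1] at hk'
      exact (hS (π x) x hk _ hk' hfin ((finite_below_map hg).2 hfin)
        (cls_eq_iff.2 ⟨g, hg, rfl, fun y _ => (hgS y).symm⟩)).symm
    · exact hinf x hfin

end Counting

/-! ### Parent maps of trees, and finite trees -/

section Trees

variable {V : Type*} {π : V → V} {T : SimpleGraph V} {a b c r x y z v w : V} {S S' D D' : Set V}
  {m N : ℕ}

/-- `π` is a parent map of `T`: the edges of `T` join each vertex to its parent. -/
def IsParent (T : SimpleGraph V) (π : V → V) : Prop :=
  ∀ x y, T.Adj x y ↔ x ≠ y ∧ (π x = y ∨ π y = x)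

theorem IsParent.adj_parent (h : IsParent T π) (hx : π x ≠ x) : T.Adj x (π x) :=
  (h _ _).2 ⟨hx.symm, Or.inl rfl⟩

theorem exists_parent (hT : T.IsTree) (r : V) :
    ∃ π : V → V, π r = r ∧ (∀ v, ∃ n, π^[n] v = r) ∧ IsParent T π := by
  classical
  choose P hP hPu using fun v => hT.existsUnique_path r v
  have hr : (P r).penultimate = r := by
    rw [← hPu r SimpleGraph.Walk.nil SimpleGraph.Walk.IsPath.nil]
    rfl
  refine ⟨fun v => (P v).penultimate, hr, fun v => ?_, fun x y => ⟨fun hxy => ?_, ?_⟩⟩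
  · induction hn : (P v).length generalizing v with
    | zero => exact ⟨0, (SimpleGraph.Walk.eq_of_length_eq_zero hn).symm⟩
    | succ n ih =>
      have h1 : (P v).dropLast = P (P v).penultimate := hPu _ _ (hP v).dropLast
      obtain ⟨k, hk⟩ := ih (P v).penultimate (by
        rw [← h1]
        simp [hn])
      exact ⟨k + 1, hk⟩
  · refine ⟨hxy.ne, ?_⟩
    by_cases hx : x ∈ (P y).support
    · exact Or.inr (hT.isAcyclic.eq_penultimate_of_adj_end (hP y) hxy.symm hx).symm
    · exact Or.inl (hT.isAcyclic.eq_penultimate_of_adj_end (hP x) hxy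
        (hT.isAcyclic.mem_support_of_ne_mem_support_of_adj_of_isPath (hP x) (hP y) hxy hx)).symm
  · have key : ∀ x, (P x).penultimate ≠ x → T.Adj (P x).penultimate x := fun x hx =>
      SimpleGraph.Walk.adj_penultimate fun hnil => hx (by
        have h0 := hnil.eq
        subst h0
        exact hr)
    rintro ⟨hne, rfl | rfl⟩
    · exact (key x hne.symm).symm
    · exact key y hne

theorem acyclic_of_root (hr : π r = r) (h : ∀ v, ∃ n, π^[n] v = r) : Acyclic π := by
  intro x n hx
  obtain ⟨k, hk⟩ := h x
  have h1 : π^[k * (n + 1)] x = x := by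
    rw [mul_comm, Function.iterate_mul]
    exact iterate_fixed hx k
  have h2 : π^[k * (n + 1)] x = r := by
    rw [show k * (n + 1) = k * n + k by ring, Function.iterate_add_apply, hk]
    exact iterate_fixed hr _
  rw [← h1, h2, hr]

theorem IsParent.kids_subset (h : IsParent T π) (v : V) : kids π v ⊆ T.neighborSet v := fun y hy =>
  ((h y v).2 ⟨hy.2, Or.inl hy.1⟩).symm

/-- A permutation that commutes with a parent map of `T` is an automorphism of `T`. -/
def IsParent.toIso (h : IsParent T π) (g : Equiv.Perm V) (hg : Function.Semiconj g π π) :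
    T ≃g T where
  toEquiv := g
  map_rel_iff' {x y} := by
    rw [h, h, ← hg x, ← hg y, g.injective.eq_iff, g.injective.eq_iff, g.injective.ne_iff]

/-- `T` is a tree with all degrees at most `N`, and all its nonidentity automorphisms move at least
`m` vertices, where `N ^ 2 ≤ 2 ^ m`. -/
structure TreeBound (T : SimpleGraph V) (m N : ℕ) : Prop where
  isTree : T.IsTree
  motion : ∀ g : T ≃g T, g ≠ SimpleGraph.Iso.refl → {x | g x ≠ x}.Finite →
    m ≤ {x | g x ≠ x}.ncard
  sq_le : N ^ 2 ≤ 2 ^ m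
  finite_neighborSet : ∀ v, (T.neighborSet v).Finite
  ncard_neighborSet_le : ∀ v, (T.neighborSet v).ncard ≤ N

theorem TreeBound.branching (hT : TreeBound T m N) (h : IsParent T π) (hac : Acyclic π) :
    Branching π m N where
  acyclic := hac
  motion g hg hne hfin := hT.motion (h.toIso g hg) (fun he => hne (Equiv.ext fun x =>
    congrArg (fun φ : T ≃g T => φ x) he)) hfin
  sq_le := hT.sq_le
  finite_kids v := (hT.finite_neighborSet v).subset (h.kids_subset v)
  ncard_kids_lt v hv := by
    refine (Set.ncard_lt_ncard ⟨h.kids_subset v, fun hsub => ?_⟩ (hT.finite_neighborSet v)).trans_le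
      (hT.ncard_neighborSet_le v)
    exact hv (hac v 1 (hsub (h.adj_parent hv)).1)

theorem TreeBound.ncard_kids_le (hT : TreeBound T m N) (h : IsParent T π) (v : V) :
    (kids π v).ncard ≤ N :=
  (Set.ncard_le_ncard (h.kids_subset v) (hT.finite_neighborSet v)).trans
    (hT.ncard_neighborSet_le v)

/-- `D` is the side of `b` with respect to the edge `ab`: the edge `ab` is the only one between
`D` and its complement. -/
structure IsSide (T : SimpleGraph V) (a b : V) (D : Set V) : Prop where
  adj : T.Adj a b
  mem : b ∈ D
  notMem : a ∉ D
  cut : ∀ x ∈ D, ∀ y ∉ D, T.Adj x y → x = b ∧ y = a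

theorem IsSide.subset (hT : T.Connected) (h : IsSide T a b D) (h' : IsSide T a b D') : D ⊆ D' := by
  intro x hx
  by_contra hx'
  obtain ⟨w⟩ := hT.preconnected x b
  suffices ∀ u, ∀ w : T.Walk u b, u ∈ D → u ∉ D' → False from this x w hx hx'
  intro u w
  induction w with
  | nil => exact fun _ h2 => h2 h'.mem
  | @cons u v b huv w ih =>
    intro h1 h2
    by_cases hv : v ∈ D
    · by_cases hv' : v ∈ D'
      · obtain ⟨-, rfl⟩ := h'.cut v hv' u h2 huv.symm
        exact h.notMem h1
      · exact ih h h' ‹_› hv hv'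
    · obtain ⟨rfl, -⟩ := h.cut u h1 v hv huv
      exact h2 h'.mem

theorem IsSide.unique (hT : T.Connected) (h : IsSide T a b D) (h' : IsSide T a b D') : D = D' :=
  (h.subset hT h').antisymm (h'.subset hT h)

theorem IsSide.compl (h : IsSide T a b D) : IsSide T b a Dᶜ where
  adj := h.adj.symm
  mem := h.notMem
  notMem hb := hb h.mem
  cut x hx y hy hxy := (h.cut y (not_not.1 hy) x hx hxy.symm).symm

theorem IsSide.image (h : IsSide T a b D) (g : T ≃g T) : IsSide T (g a) (g b) (g '' D) where
  adj := g.map_adj_iff.2 h.adj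
  mem := ⟨b, h.mem, rfl⟩
  notMem := by
    rintro ⟨x, hx, he⟩
    exact h.notMem (g.injective he ▸ hx)
  cut := by
    rintro _ ⟨x, hx, rfl⟩ y hy hxy
    obtain ⟨y, rfl⟩ := g.surjective y
    obtain ⟨rfl, rfl⟩ := h.cut x hx y (fun h' => hy ⟨y, h', rfl⟩) (g.map_adj_iff.1 hxy)
    exact ⟨rfl, rfl⟩

theorem isSide_below (h : IsParent T π) (hac : Acyclic π) (hy : π y ≠ y) :
    IsSide T (π y) y (below π y) where
  adj := (h.adj_parent hy).symm
  mem := self_mem_below y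
  notMem := notMem_below_kid hac ⟨rfl, fun e => hy e.symm⟩
  cut x hx z hz hxz := by
    obtain ⟨-, rfl | rfl⟩ := (h x z).1 hxz
    · by_cases hxy : x = y
      · exact ⟨hxy, by rw [hxy]⟩
      · exact absurd (parent_mem_below hx hxy) hz
    · exact absurd (mem_below_of_parent hx) hz

theorem root_notMem_below (hr : π r = r) (hx : x ≠ r) : r ∉ below π x := by
  rintro ⟨n, hn⟩
  rw [iterate_fixed hr] at hn
  exact hx hn.symm

/-- An automorphism that fixes the root commutes with the parent map. -/
theorem semiconj_of_fix_root (hT : T.Connected) (h : IsParent T π) (hr : π r = r)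
    (hroot : ∀ v, ∃ n, π^[n] v = r) (g : T ≃g T) (hg : g r = r) :
    Function.Semiconj g π π := by
  have hac := acyclic_of_root hr hroot
  intro x
  by_cases hx : π x = x
  · obtain ⟨n, hn⟩ := hroot x
    rw [iterate_fixed hx] at hn
    subst hn
    rw [hr, hg, hr]
  · have hxr : x ≠ r := fun e => hx (e ▸ hr)
    obtain ⟨hne, h1 | h1⟩ := (h (g x) (g (π x))).1 (g.map_adj_iff.2 (h.adj_parent hx))
    · exact h1.symm
    · exfalso
      have h2 : π (g (π x)) ≠ g (π x) := by rwa [h1]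
      have h3 := (isSide_below h hac h2).compl
      rw [h1] at h3
      have h4 := h3.unique hT ((isSide_below h hac hx).image g)
      have h5 : r ∈ (below π (g (π x)))ᶜ := root_notMem_below hr fun e => h2 (by rw [e, hr])
      rw [h4] at h5
      obtain ⟨t, ht, htr⟩ := h5
      rw [← hg] at htr
      exact root_notMem_below hr hxr (g.injective htr ▸ ht)

/-- A finite tree has a centroid: a vertex none of whose branches contains more than half of all
vertices. -/
theorem exists_centroid [Finite V] (hT : T.IsTree) :
    ∃ c, ∀ b D, IsSide T c b D → 2 * D.ncard ≤ Nat.card V := by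
  classical
  obtain ⟨r⟩ := hT.connected.nonempty
  obtain ⟨π, hr, hroot, hπ⟩ := exists_parent hT r
  have hac := acyclic_of_root hr hroot
  have hall : below π r = Set.univ := Set.eq_univ_of_forall hroot
  -- The centroid is a vertex with the smallest branch among those whose branches contain half of
  -- all vertices.
  obtain ⟨c, hc, hmin⟩ := Set.exists_min_image {v | Nat.card V ≤ 2 * (below π v).ncard}
    (fun v => (below π v).ncard) (Set.toFinite _) ⟨r, by
      simp only [Set.mem_ofPred_eq, hall, Set.ncard_univ]
      omega⟩
  refine ⟨c, fun b D hD => ?_⟩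
  obtain ⟨hne, h | h⟩ := (hπ c b).1 hD.adj
  · subst h
    rw [hD.unique hT.connected (isSide_below hπ hac hne.symm).compl]
    have := Set.ncard_add_ncard_compl (below π c)
    simp only [Set.mem_ofPred_eq] at hc
    omega
  · subst h
    rw [hD.unique hT.connected (isSide_below hπ hac hne)]
    by_contra hcon
    have hk : b ∈ kids π (π b) := ⟨rfl, hne.symm⟩
    have h1 := hmin b (by simp only [Set.mem_ofPred_eq]; omega)
    have h2 : (below π b).ncard < (below π (π b)).ncard := Set.ncard_lt_ncard
      ⟨below_subset (mem_below_of_mem_kids hk), fun hs =>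
        notMem_below_kid hac hk (hs (self_mem_below _))⟩
    omega

/-- An automorphism that moves a centroid exchanges the two sides of an edge, each of which
contains half of all vertices. -/
theorem exists_swapped_side [Finite V] (hT : T.IsTree)
    (hc : ∀ b D, IsSide T c b D → 2 * D.ncard ≤ Nat.card V) (g : T ≃g T) (hg : g c ≠ c) :
    ∃ H : Set V, g '' Hᶜ = H := by
  obtain ⟨π, hr, hroot, hπ⟩ := exists_parent hT c
  have hac := acyclic_of_root hr hroot
  have hc' : ∀ b D, IsSide T (g c) b D → 2 * D.ncard ≤ Nat.card V := by
    intro b D hD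
    have h1 := hD.image g.symm
    rw [g.symm_apply_apply] at h1
    have h2 := hc _ _ h1
    rwa [Set.ncard_image_of_injective _ g.symm.injective] at h2
  obtain ⟨u, hu, hgu⟩ := (eq_or_exists_kid (hroot (g c))).resolve_left hg
  have hune := parent_ne_of_mem_kids hu
  have hgc : π (g c) ≠ g c := parent_ne_of_mem_below hune hgu
  have hU := isSide_below hπ hac hune
  rw [hu.1] at hU
  have h1 := hc _ _ hU
  have h2 := hc' _ _ (isSide_below hπ hac hgc).compl
  have h3 := Set.ncard_add_ncard_compl (below π (g c))
  have h4 := below_subset hgu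
  have h5 := Set.ncard_le_ncard h4
  have h6 : below π (g c) = below π u := Set.eq_of_subset_of_ncard_le h4 (by omega)
  have h7 : g c = u := by
    by_contra hne
    have h8 : u ∈ below π (g c) := h6 ▸ self_mem_below u
    have h9 := parent_mem_below h8 (Ne.symm hne)
    rw [hu.1, h6] at h9
    exact notMem_below_kid hac hu h9
  refine ⟨below π u, ?_⟩
  have h8 := hU.compl.image g
  rw [h7] at h8
  by_cases hgu : g u = c
  · rw [hgu] at h8
    exact h8.unique hT.connected hU
  · exfalso
    obtain ⟨hne, h9 | h9⟩ := (hπ _ _).1 h8.adj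
    · have h10 := (isSide_below hπ hac (y := g u) (by rw [h9]; exact hne.symm)).compl
      rw [h9] at h10
      have h11 := h10.unique hT.connected h8
      have h12 := congrArg Set.ncard h11
      rw [Set.ncard_image_of_injective _ g.injective] at h12
      have h13 := Set.ncard_add_ncard_compl (below π u)
      have h14 := Set.ncard_add_ncard_compl (below π (g u))
      have hk : g u ∈ kids π u := ⟨h9, hne⟩
      have h15 : (below π (g u)).ncard < (below π u).ncard := Set.ncard_lt_ncard
        ⟨below_subset (mem_below_of_mem_kids hk), fun hs =>
          notMem_below_kid hac hk (hs (self_mem_below _))⟩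
      omega
    · rw [hu.1] at h9
      exact hgu h9.symm

/-- The set is a colouring that separates the children of every vertex, with a centroid as the
root, of odd cardinality: an automorphism moving the centroid would exchange two halves of the
tree, and preserve only sets of even cardinality. -/
theorem TreeBound.twoDistinguishable_of_finite [Finite V] (hT : TreeBound T m N) :
    T.TwoDistinguishable := by
  classical
  obtain ⟨c, hc⟩ := exists_centroid hT.isTree
  obtain ⟨π, hr, hroot, hπ⟩ := exists_parent hT.isTree c
  have hac := acyclic_of_root hr hroot
  have hB := hT.branching hπ hac
  obtain ⟨S₀, -, hgood, hsep⟩ := hB.exists_separating (v := c) (hT.ncard_kids_le hπ c) (kids π c)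
    (fun y hy => ⟨hy, Set.toFinite _⟩) (fun y hy z _ hy' => absurd hy hy') ∅
  have hsep₀ : ∀ x, SeparatesAt π S₀ x := fun x => Good.of_kids hgood hsep x (hroot x)
  obtain ⟨S, hS, hodd⟩ : ∃ S : Set V, (∀ x, x ≠ c → (x ∈ S₀ ↔ x ∈ S)) ∧ Odd S.ncard := by
    rcases Nat.even_or_odd S₀.ncard with he | ho
    · by_cases hcS : c ∈ S₀
      · refine ⟨S₀ \ {c}, fun x hx => by simp [hx], ?_⟩
        have := Set.ncard_sdiff_singleton_add_one hcS
        rw [← this] at he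
        rwa [Nat.even_add_one, Nat.not_even_iff_odd] at he
      · refine ⟨insert c S₀, fun x hx => by simp [hx], ?_⟩
        rw [Set.ncard_insert_of_notMem hcS]
        exact he.add_one
    · exact ⟨S₀, fun _ _ => Iff.rfl, ho⟩
  refine ⟨S, fun g hg => ?_⟩
  have hgS : ∀ x, g x ∈ S ↔ x ∈ S := fun x => by
    conv_lhs => rw [← hg]
    exact g.injective.mem_set_image
  have hgc : g c = c := by
    by_contra hne
    obtain ⟨H, hH⟩ := exists_swapped_side hT.isTree hc g hne
    have h1 : g '' (S \ H) = S ∩ H := by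
      rw [Set.sdiff_eq, Set.image_inter g.injective, hg, hH]
    have h2 := congrArg Set.ncard h1
    rw [Set.ncard_image_of_injective _ g.injective] at h2
    have h3 := Set.ncard_inter_add_ncard_sdiff_eq_ncard S H
    rw [h2] at h3
    exact (Nat.not_odd_iff_even.2 ⟨_, h3.symm⟩) hodd
  have hsemi := semiconj_of_fix_root hT.isTree.connected hπ hr hroot g hgc
  have h1 : g.toEquiv = 1 := by
    refine eq_one_of_separates (S := S) (π := π) hsemi (fun x => ?_) hgS
      (fun x hx => absurd (Set.toFinite _) hx) fun x => ?_
    · refine (hsep₀ x).congr fun y hy _ t ht => hS t ?_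
      rintro rfl
      refine root_notMem_below hr ?_ ht
      rintro rfl
      exact parent_ne_of_mem_kids hy hr
    · obtain ⟨n, hn⟩ := hroot x
      exact ⟨n, by rw [hn]; exact hgc⟩
  ext x
  exact congrArg (fun e : Equiv.Perm V => e x) h1

end Trees

/-! ### Infinite trees rooted at an end -/

section EndRooted

variable {V : Type*} {π : V → V} {T : SimpleGraph V} {r : ℕ → V} {x y z v w : V}
  {S S' K : Set V} {m N : ℕ} {ℓ : V → ℤ}

/-- `π` is a parent map of `T` that is rooted at the end of the ray `r`: it shifts `r`, and every
vertex is mapped into `r` by some iterate of `π`. -/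
structure IsEndParent (T : SimpleGraph V) (π : V → V) (r : ℕ → V) : Prop where
  isParent : IsParent T π
  parent_ray : ∀ i, π (r i) = r (i + 1)
  injective : Function.Injective r
  reaches : ∀ v, ∃ n i, π^[n] v = r i

theorem exists_infinite_kid (hk : (kids π v).Finite) (hv : ¬ (below π v).Finite) :
    ∃ y ∈ kids π v, ¬ (below π y).Finite := by
  by_contra! hcon
  refine hv (((Set.finite_singleton v).union (hk.biUnion hcon)).subset fun x hx => ?_)
  rcases eq_or_exists_kid hx with h | ⟨y, hy, hxy⟩
  · exact Or.inl h
  · exact Or.inr (Set.mem_biUnion hy hxy)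

theorem countable_of_root {c : V} (hroot : ∀ v, ∃ n, π^[n] v = c) (hk : ∀ v, (kids π v).Finite) :
    Countable V := by
  have h : ∀ n, {v | π^[n] v = c}.Finite := by
    intro n
    induction n with
    | zero => exact Set.finite_singleton c
    | succ n ih =>
      refine (ih.union (ih.biUnion fun w _ => hk w)).subset fun v hv => ?_
      by_cases hvv : π v = v
      · left
        have : π^[n] v = c := by
          rw [← hv, iterate_fixed hvv, iterate_fixed hvv]
        exact this
      · right
        exact Set.mem_biUnion (x := π v) hv ⟨rfl, fun h => hvv h.symm⟩
  rw [← Set.countable_univ_iff]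
  refine (Set.countable_iUnion fun n => (h n).countable).mono fun v _ => ?_
  obtain ⟨n, hn⟩ := hroot v
  exact Set.mem_iUnion.2 ⟨n, hn⟩

theorem countable_of_locallyFinite (hT : T.IsTree) (hf : ∀ v, (T.neighborSet v).Finite) :
    Countable V := by
  obtain ⟨c⟩ := hT.connected.nonempty
  obtain ⟨π, -, hroot, hπ⟩ := exists_parent hT c
  exact countable_of_root hroot fun v => (hf v).subset (hπ.kids_subset v)

/-- An infinite, locally finite tree contains a ray, and it can be rooted at the end of this ray.
The parent map is obtained from one with the origin of the ray as the root, by reversing the edges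
of the ray. -/
theorem exists_isEndParent [Infinite V] (hT : T.IsTree) (hf : ∀ v, (T.neighborSet v).Finite) :
    ∃ π r, IsEndParent T π r := by
  classical
  obtain ⟨c⟩ := hT.connected.nonempty
  obtain ⟨p, hc, hroot, hp⟩ := exists_parent hT c
  have hac := acyclic_of_root hc hroot
  have hstep : ∀ v : {v // ¬ (below p v).Finite}, ∃ y : {v // ¬ (below p v).Finite},
      (y : V) ∈ kids p v := fun v => by
    obtain ⟨y, hy, hyf⟩ := exists_infinite_kid ((hf v).subset (hp.kids_subset v)) v.2
    exact ⟨⟨y, hyf⟩, hy⟩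
  choose next hnext using hstep
  have hcinf : ¬ (below p c).Finite := by
    rw [show below p c = Set.univ from Set.eq_univ_of_forall hroot]
    exact Set.infinite_univ
  set q : ℕ → {v // ¬ (below p v).Finite} := fun i => next^[i] ⟨c, hcinf⟩ with hq
  set r : ℕ → V := fun i => q i with hr
  have hkid : ∀ i, r (i + 1) ∈ kids p (r i) := fun i => by
    simp only [hr, hq, Function.iterate_succ_apply']
    exact hnext _
  have hbel : ∀ i k, r (i + k) ∈ below p (r i) := by
    intro i k
    induction k with
    | zero => exact self_mem_below _
    | succ k ih => exact mem_below_trans (mem_below_of_mem_kids (hkid (i + k))) ih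
  have hinj : Function.Injective r := by
    have key : ∀ i j, i < j → r i ≠ r j := by
      intro i j hij he
      obtain ⟨k, rfl⟩ : ∃ k, j = (i + 1) + k := ⟨j - (i + 1), by omega⟩
      have := hbel (i + 1) k
      rw [← he] at this
      exact notMem_below_kid hac (hkid i) this
    intro i j he
    rcases lt_trichotomy i j with h | h | h
    · exact absurd he (key i j h)
    · exact h
    · exact absurd he.symm (key j i h)
  have hr0 : r 0 = c := rfl
  set π : V → V := fun v => if h : ∃ i, r i = v then r (h.choose + 1) else p v with hπ
  have hπr : ∀ i, π (r i) = r (i + 1) := by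
    intro i
    have h : ∃ j, r j = r i := ⟨i, rfl⟩
    simp only [hπ, dif_pos h]
    rw [hinj h.choose_spec]
  have hπn : ∀ v, (¬ ∃ i, r i = v) → π v = p v := fun v h => by
    simp only [hπ, dif_neg h]
  refine ⟨π, r, ⟨fun x y => ?_, hπr, hinj, fun v => ?_⟩⟩
  · rw [hp x y]
    have key1 : ∀ x y, x ≠ y → p x = y → (π x = y ∨ π y = x) := by
      intro x y hne hxy
      by_cases hx : ∃ i, r i = x
      · obtain ⟨i, rfl⟩ := hx
        cases i with
        | zero => exact absurd (by rw [← hxy, hr0, hc]) hne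
        | succ i =>
          right
          rw [← hxy, (hkid i).1, hπr]
      · left
        rw [hπn x hx, hxy]
    have key2 : ∀ x y, π x = y → (p x = y ∨ p y = x) := by
      intro x y hxy
      by_cases hx : ∃ i, r i = x
      · obtain ⟨i, rfl⟩ := hx
        right
        rw [← hxy, hπr, (hkid i).1]
      · left
        rw [← hπn x hx, hxy]
    refine and_congr_right fun hne => ⟨?_, ?_⟩
    · rintro (h | h)
      · exact key1 x y hne h
      · exact (key1 y x hne.symm h).symm
    · rintro (h | h)
      · exact key2 x y h
      · exact (key2 y x h).symm
  · obtain ⟨n, hn⟩ := hroot v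
    induction n generalizing v with
    | zero => exact ⟨0, 0, hn⟩
    | succ n ih =>
      by_cases hv : ∃ i, r i = v
      · obtain ⟨i, rfl⟩ := hv
        exact ⟨0, i, rfl⟩
      · obtain ⟨k, i, hk⟩ := ih (p v) hn
        refine ⟨k + 1, i, ?_⟩
        rw [Function.iterate_succ_apply, hπn v hv, hk]

theorem IsEndParent.iterate_ray (h : IsEndParent T π r) (n i : ℕ) : π^[n] (r i) = r (i + n) := by
  induction n with
  | zero => rfl
  | succ n ih => rw [Function.iterate_succ_apply', ih, h.parent_ray, add_assoc]

theorem IsEndParent.iterate_ne (h : IsEndParent T π r) (x : V) (n : ℕ) : π^[n + 1] x ≠ x := by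
  intro hx
  obtain ⟨k, i, hk⟩ := h.reaches x
  have h1 : π^[n + 1] (r i) = r i := by
    rw [← hk, ← Function.iterate_add_apply, add_comm, Function.iterate_add_apply, hx]
  rw [h.iterate_ray] at h1
  have := h.injective h1
  omega

theorem IsEndParent.acyclic (h : IsEndParent T π r) : Acyclic π := fun x n hx =>
  absurd hx (h.iterate_ne x n)

theorem IsEndParent.parent_ne (h : IsEndParent T π r) (x : V) : π x ≠ x := h.iterate_ne x 0

/-- The level of a vertex: it increases by one towards the end, and the origin of the ray has
level zero. -/
theorem IsEndParent.exists_level (h : IsEndParent T π r) :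
    ∃ ℓ : V → ℤ, (∀ v, ℓ (π v) = ℓ v + 1) ∧ ∀ i, ℓ (r i) = i := by
  choose n i hni using h.reaches
  have key : ∀ v a j, π^[a] v = r j → (i v : ℤ) - n v = (j : ℤ) - a := by
    intro v a j ha
    have h1 : π^[a + n v] v = r (i v + a) := by
      rw [Function.iterate_add_apply, hni, h.iterate_ray]
    have h2 : π^[n v + a] v = r (j + n v) := by
      rw [Function.iterate_add_apply, ha, h.iterate_ray]
    rw [add_comm, h2] at h1
    have := h.injective h1
    omega
  refine ⟨fun v => (i v : ℤ) - n v, fun v => ?_, fun j => ?_⟩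
  · have h1 : π^[n (π v) + 1] v = r (i (π v)) := by
      rw [Function.iterate_succ_apply, hni]
    have := key v _ _ h1
    push_cast at this
    simp only
    omega
  · have := key (r j) 0 j rfl
    simpa using this

theorem level_iterate (hℓ : ∀ v, ℓ (π v) = ℓ v + 1) (n : ℕ) (v : V) :
    ℓ (π^[n] v) = ℓ v + n := by
  induction n with
  | zero => simp
  | succ n ih =>
    rw [Function.iterate_succ_apply', hℓ, ih]
    push_cast
    ring

theorem exists_deep (hk : ∀ v, (kids π v).Finite) (hℓ : ∀ v, ℓ (π v) = ℓ v + 1)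
    (hv : ¬ (below π v).Finite) (z : ℤ) :
    ∃ k, ¬ (below π k).Finite ∧ k ∈ below π v ∧ ℓ k < z := by
  have key : ∀ n : ℕ, ∃ k, ¬ (below π k).Finite ∧ k ∈ below π v ∧ ℓ k + n = ℓ v := by
    intro n
    induction n with
    | zero => exact ⟨v, hv, self_mem_below v, by simp⟩
    | succ n ih =>
      obtain ⟨k, hkf, hkv, hkn⟩ := ih
      obtain ⟨y, hy, hyf⟩ := exists_infinite_kid (hk k) hkf
      refine ⟨y, hyf, mem_below_trans (mem_below_of_mem_kids hy) hkv, ?_⟩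
      have := hℓ y
      rw [hy.1] at this
      push_cast
      omega
  obtain ⟨k, h1, h2, h3⟩ := key ((ℓ v - z).toNat + 1)
  refine ⟨k, h1, h2, ?_⟩
  push_cast at h3
  have := Int.self_le_toNat (ℓ v - z)
  omega

/-- There is a set `K` of vertices of negative levels, with infinite branches, that meets every
infinite branch, and no two elements of which are at the same level or at consecutive levels. -/
theorem exists_sparse [Countable V] (hk : ∀ v, (kids π v).Finite) (hℓ : ∀ v, ℓ (π v) = ℓ v + 1) :
    ∃ K : Set V, (∀ k ∈ K, ¬ (below π k).Finite ∧ ℓ k < 0) ∧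
      (∀ k ∈ K, ∀ k' ∈ K, ℓ k = ℓ k' ∨ ℓ k = ℓ k' + 1 → k = k') ∧
      ∀ v, ¬ (below π v).Finite → ∃ k ∈ K, k ∈ below π v := by
  rcases Set.eq_empty_or_nonempty {v | ¬ (below π v).Finite} with hC | hC
  · exact ⟨∅, by simp, by simp, fun v hv => absurd hv (Set.eq_empty_iff_forall_notMem.1 hC v)⟩
  obtain ⟨e, he⟩ := (Set.to_countable {v | ¬ (below π v).Finite}).exists_eq_range hC
  have hef : ∀ n, ¬ (below π (e n)).Finite := fun n => by
    have : e n ∈ {v | ¬ (below π v).Finite} := he ▸ Set.mem_range_self n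
    exact this
  choose d hd1 hd2 hd3 using fun n z => exists_deep hk hℓ (hef n) z
  set k : ℕ → V := fun n => Nat.rec (d 0 0) (fun n x => d (n + 1) (ℓ x - 1)) n with hkdef
  have hk0 : k 0 = d 0 0 := rfl
  have hks : ∀ n, k (n + 1) = d (n + 1) (ℓ (k n) - 1) := fun n => rfl
  have hlt : ∀ n, ℓ (k (n + 1)) < ℓ (k n) - 1 := fun n => by rw [hks]; exact hd3 _ _
  have hlt' : ∀ n j, ℓ (k (n + j + 1)) < ℓ (k n) - 1 := by
    intro n j
    induction j with
    | zero => exact hlt n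
    | succ j ih =>
      have := hlt (n + j + 1)
      rw [← add_assoc]
      omega
  have hneg : ∀ n, ℓ (k n) < 0 := by
    intro n
    have h0 : ℓ (k 0) < 0 := hd3 0 0
    cases n with
    | zero => exact h0
    | succ n =>
      have := hlt' 0 n
      rw [zero_add] at this
      omega
  refine ⟨Set.range k, ?_, ?_, ?_⟩
  · rintro _ ⟨n, rfl⟩
    refine ⟨?_, hneg n⟩
    cases n with
    | zero => exact hd1 _ _
    | succ n => rw [hks]; exact hd1 _ _
  · rintro _ ⟨n, rfl⟩ _ ⟨n', rfl⟩ hl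
    rcases lt_trichotomy n n' with hn | rfl | hn
    · obtain ⟨j, rfl⟩ : ∃ j, n' = n + j + 1 := ⟨n' - n - 1, by omega⟩
      have := hlt' n j
      omega
    · rfl
    · obtain ⟨j, rfl⟩ : ∃ j, n = n' + j + 1 := ⟨n - n' - 1, by omega⟩
      have := hlt' n' j
      omega
  · intro v hv
    obtain ⟨n, rfl⟩ : v ∈ Set.range e := he ▸ hv
    refine ⟨k n, ⟨n, rfl⟩, ?_⟩
    cases n with
    | zero => exact hd2 _ _
    | succ n => rw [hks]; exact hd2 _ _

/-- A colouring prescribed on the ray and on the vertices with infinite branches extends to one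
that separates the children of every vertex. The colours of the finite branches at the vertices
off the ray can be chosen independently of each other; along the ray they are chosen recursively,
because the branch at `r i` may be finite and isomorphic to branches at siblings of `r i`. -/
theorem Branching.exists_separating_extension (hB : Branching π m N) (h : IsEndParent T π r)
    (Z : Set V) : ∃ S : Set V, (∀ x, ¬ (below π x).Finite → (x ∈ S ↔ x ∈ Z)) ∧
      (∀ i, r i ∈ S ↔ r i ∈ Z) ∧ ∀ x, SeparatesAt π S x := by
  classical
  have hac := h.acyclic
  set X : Set V := {x | ¬ (below π x).Finite ∨ ∃ i, r i = x} with hX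
  -- The vertices with prescribed colours; the set is closed under taking parents.
  have hXr : ∀ i, r i ∈ X := fun i => Or.inr ⟨i, rfl⟩
  have hXup : ∀ x, x ∈ X → π x ∈ X := by
    rintro x (hx | ⟨i, rfl⟩)
    · exact Or.inl fun hf => hx (hf.subset (below_subset ⟨1, rfl⟩))
    · rw [h.parent_ray]; exact hXr _
  have hXbel : ∀ x w, x ∈ below π w → x ∈ X → w ∈ X := by
    rintro x w ⟨n, rfl⟩ hx
    induction n with
    | zero => exact hx
    | succ n ih => rw [Function.iterate_succ_apply']; exact hXup _ ih
  set F : V → Set V := fun x => kids π x \ X with hF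
  have hstep : ∀ x (S₀ : Set V), ∃ S, (∀ t, (∀ y ∈ F x, t ∉ below π y) → (t ∈ S ↔ t ∈ S₀)) ∧
      (∀ y ∈ F x, Good π S y) ∧ SeparatesAt π S x := by
    intro x S₀
    refine hB.exists_separating (hB.ncard_kids_lt x (h.parent_ne x)).le (F x)
      (fun y hy => ⟨hy.1, ?_⟩) (fun y hy z hz hyF hzF hfy hfz => ?_) S₀
    · by_contra hinf
      exact hy.2 (Or.inl hinf)
    · have key : ∀ {y}, y ∈ kids π x → y ∉ F x → (below π y).Finite → ∃ i, r i = y := by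
        intro y hy hyF hfy
        have hyX : y ∈ X := by
          by_contra hyX
          exact hyF ⟨hy, hyX⟩
        exact hyX.resolve_left (not_not.2 hfy)
      obtain ⟨i, rfl⟩ := key hy hyF hfy
      obtain ⟨j, rfl⟩ := key hz hzF hfz
      have h1 := hy.1.trans hz.1.symm
      rw [h.parent_ray, h.parent_ray] at h1
      have := h.injective h1
      congr 1
      omega
  choose step hs1 hs2 hs3 using hstep
  set R : ℕ → Set V := fun i => Nat.rec (step (r 0) Z) (fun i s => step (r (i + 1)) s) i with hR
  have hRs : ∀ i, R (i + 1) = step (r (i + 1)) (R i) := fun i => rfl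
  set Q : V → Set V := fun x => if hx : ∃ i, r i = x then R hx.choose else step x Z with hQ
  -- `Q x` is the colouring used for the branches at the children of `x` outside `X`.
  have hQr : ∀ i, Q (r i) = R i := by
    intro i
    have hx : ∃ j, r j = r i := ⟨i, rfl⟩
    simp only [hQ, dif_pos hx]
    rw [h.injective hx.choose_spec]
  have hQs : ∀ x, ∃ S₀, Q x = step x S₀ := by
    intro x
    by_cases hx : ∃ i, r i = x
    · obtain ⟨i, rfl⟩ := hx
      rw [hQr]
      cases i with
      | zero => exact ⟨_, rfl⟩
      | succ i => exact ⟨_, hRs i⟩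
    · exact ⟨Z, by simp only [hQ, dif_neg hx]⟩
  -- The branches hanging off `X` are pairwise disjoint, and cover the complement of `X`.
  have huniq : ∀ {t w w'}, t ∈ below π w → t ∈ below π w' → π w ∈ X → π w' ∈ X → w ∉ X → w' ∉ X →
      w = w' := by
    have key : ∀ {w w'}, w ∈ below π w' → π w ∈ X → w' ∉ X → w = w' := by
      intro w w' hw hwX hw'
      by_contra hne
      exact hw' (hXbel _ _ (parent_mem_below hw hne) hwX)
    intro t w w' h1 h2 h3 h4 h5 h6
    rcases below_comparable h1 h2 with h7 | h7
    · exact key h7 h3 h6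
    · exact (key h7 h4 h5).symm
  have hcover : ∀ t, t ∉ X → ∃ w, π w ∈ X ∧ w ∉ X ∧ t ∈ below π w := by
    intro t ht
    obtain ⟨n, i, hn⟩ := h.reaches t
    induction n generalizing t with
    | zero => exact absurd (by rw [show t = r i from hn]; exact hXr i) ht
    | succ n ih =>
      by_cases hπ : π t ∈ X
      · exact ⟨t, hπ, ht, self_mem_below t⟩
      · obtain ⟨w, h1, h2, h3⟩ := ih (π t) hπ hn
        exact ⟨w, h1, h2, mem_below_of_parent h3⟩
  have hwF : ∀ {w}, w ∉ X → w ∈ F (π w) := fun {w} hw => ⟨⟨rfl, (h.parent_ne w).symm⟩, hw⟩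
  set S : Set V := {t | (t ∈ X ∧ t ∈ Z) ∨ ∃ w, π w ∈ X ∧ w ∉ X ∧ t ∈ below π w ∧ t ∈ Q (π w)}
    with hS
  have hSX : ∀ t, t ∈ X → (t ∈ S ↔ t ∈ Z) := by
    intro t ht
    refine ⟨?_, fun hz => Or.inl ⟨ht, hz⟩⟩
    rintro (⟨-, hz⟩ | ⟨w, -, hw, htw, -⟩)
    · exact hz
    · exact absurd (hXbel _ _ htw ht) hw
  have hSQ : ∀ w, π w ∈ X → w ∉ X → ∀ t ∈ below π w, (t ∈ Q (π w) ↔ t ∈ S) := by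
    intro w hw1 hw2 t ht
    refine ⟨fun hq => Or.inr ⟨w, hw1, hw2, ht, hq⟩, ?_⟩
    rintro (⟨htX, -⟩ | ⟨w', h1, h2, h3, h4⟩)
    · exact absurd (hXbel _ _ ht htX) hw2
    · rwa [huniq ht h3 hw1 h1 hw2 h2]
  have hRX : ∀ i, ∀ t ∈ X, (t ∈ R i ↔ t ∈ Z) := by
    intro i t ht
    have key : ∀ x S₀, t ∈ step x S₀ ↔ t ∈ S₀ := fun x S₀ =>
      hs1 x S₀ t fun y hy hty => hy.2 (hXbel _ _ hty ht)
    induction i with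
    | zero => exact key _ _
    | succ i ih => exact (key _ _).trans ih
  refine ⟨S, fun x hx => hSX x (Or.inl hx), fun i => hSX _ (hXr i), fun x => ?_⟩
  by_cases hxX : x ∈ X
  · obtain ⟨S₀, hS₀⟩ := hQs x
    have hsep : SeparatesAt π (Q x) x := hS₀ ▸ hs3 x S₀
    refine hsep.congr fun y hy hfy t ht => ?_
    by_cases hyX : y ∈ X
    · obtain ⟨i, rfl⟩ := hyX.resolve_left (not_not.2 hfy)
      obtain rfl : r (i + 1) = x := by rw [← hy.1, h.parent_ray]
      rw [hQr]
      by_cases htX : t ∈ X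
      · exact (hRX (i + 1) t htX).trans (hSX t htX).symm
      · obtain ⟨w, h1, h2, h3⟩ := hcover t htX
        have h4 : π w ∈ below π (r i) := by
          rcases below_comparable h3 ht with h4 | h4
          · exact parent_mem_below h4 fun e => h2 (e ▸ hXr i)
          · exact absurd (hXbel _ _ h4 (hXr i)) h2
        obtain ⟨j, hj⟩ := h1.resolve_left (not_not.2 (hfy.subset (below_subset h4)))
        obtain ⟨n, hn⟩ := h4
        rw [← hj, h.iterate_ray] at hn
        obtain rfl := h.injective hn
        rw [← hSQ w h1 h2 t h3, ← hj, hQr]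
        have key : ∀ k, t ∈ R (j + k) ↔ t ∈ R j := by
          intro k
          induction k with
          | zero => rfl
          | succ k ih =>
            rw [← ih, ← add_assoc, hRs]
            refine hs1 _ _ t fun w' hw' htw' => ?_
            have h5 : w = w' := huniq h3 htw' h1 (by rw [hw'.1.1]; exact hXr _) h2 hw'.2
            have h6 := hw'.1.1
            rw [← h5, ← hj] at h6
            have := h.injective h6
            omega
        exact key (n + 1)
    · have h1 := hSQ y (by rw [hy.1]; exact hxX) hyX t ht
      rwa [hy.1] at h1
  · obtain ⟨w, h1, h2, h3⟩ := hcover x hxX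
    obtain ⟨S₀, hS₀⟩ := hQs (π w)
    have hg : Good π (Q (π w)) w := hS₀ ▸ hs2 (π w) S₀ w (hwF h2)
    refine (hg x h3).congr fun y hy _ t ht => hSQ w h1 h2 t ?_
    exact mem_below_trans (mem_below_trans ht (mem_below_of_mem_kids hy)) h3

end EndRooted

/-! ### Colourings that determine the end and break all symmetries -/

section Coding

variable {V : Type*} {π : V → V} {T : SimpleGraph V} {r : ℕ → V} {x y z v w : V}
  {S S' K : Set V} {P P' : Set ℕ} {m N : ℕ} {ℓ : V → ℤ}

/-- The colouring `S` prescribed on the vertices with infinite branches and on the ray: `P` is the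
set of coloured positions of the ray, and `K` the set of coloured vertices of negative level with
infinite branches. -/
structure IsCoded (π : V → V) (r : ℕ → V) (ℓ : V → ℤ) (K : Set V) (P : Set ℕ) (S : Set V) :
    Prop where
  mem_iff_of_infinite : ∀ x, ¬ (below π x).Finite → ℓ x < 0 → (x ∈ S ↔ x ∈ K)
  ray_mem_iff : ∀ i, r i ∈ S ↔ i ∈ P

/-- A path that leaves a vertex downwards continues downwards for ever. -/
theorem IsEndParent.descends (h : IsEndParent T π r) {s : ℕ → V} (hs : Function.Injective s)
    (hadj : ∀ i, T.Adj (s i) (s (i + 1))) {i : ℕ} (hi : π (s (i + 1)) = s i) (k : ℕ) :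
    π (s (i + k + 1)) = s (i + k) := by
  induction k with
  | zero => exact hi
  | succ k ih =>
    obtain ⟨-, h1 | h1⟩ := (h.isParent _ _).1 (hadj (i + (k + 1)))
    · have h2 := hs (h1.symm.trans ih)
      omega
    · exact h1

/-- The end of the ray `r` is the only one to which there is a ray with infinitely many pairs of
adjacent coloured vertices. Therefore it is fixed by the automorphisms that respect coded
colourings. -/
theorem IsEndParent.semiconj (h : IsEndParent T π r) (hℓ : ∀ v, ℓ (π v) = ℓ v + 1)
    (hK : ∀ k ∈ K, ∀ k' ∈ K, ℓ k = ℓ k' ∨ ℓ k = ℓ k' + 1 → k = k')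
    (hP : ∀ n, ∃ i ≥ n, i ∈ P ∧ i + 1 ∈ P) (hS : IsCoded π r ℓ K P S)
    (hS' : IsCoded π r ℓ K P' S') (g : T ≃g T) (hg : ∀ x, g x ∈ S' ↔ x ∈ S) :
    Function.Semiconj g π π := by
  have hray : ∀ i, T.Adj (r i) (r (i + 1)) := fun i => by
    have := h.isParent.adj_parent (h.parent_ne (r i))
    rwa [h.parent_ray] at this
  have hup : ∀ i, π (g (r i)) = g (r (i + 1)) := by
    intro i
    have hinj : Function.Injective fun i => g (r i) := g.injective.comp h.injective
    have hadj : ∀ i, T.Adj (g (r i)) (g (r (i + 1))) := fun i => g.map_adj_iff.2 (hray i)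
    obtain ⟨-, h1 | h1⟩ := (h.isParent _ _).1 (hadj i)
    · exact h1
    · exfalso
      have hd := h.descends hinj hadj h1
      have hbel : ∀ k j, g (r (i + k + j)) ∈ below π (g (r (i + k))) := by
        intro k j
        induction j with
        | zero => exact self_mem_below _
        | succ j ih =>
          refine mem_below_of_parent ?_
          have := hd (k + j)
          rw [← add_assoc] at this
          rw [← add_assoc, this]
          exact ih
      have hinf : ∀ k, ¬ (below π (g (r (i + k)))).Finite := by
        intro k hf
        refine Set.infinite_range_of_injective (f := fun j => g (r (i + k + j)))
          (fun a b hab => ?_) (hf.subset ?_)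
        · have := hinj hab
          omega
        · rintro _ ⟨j, rfl⟩
          exact hbel k j
      have hlev : ∀ k : ℕ, ℓ (g (r (i + k))) = ℓ (g (r i)) - k := by
        intro k
        induction k with
        | zero => simp
        | succ k ih =>
          have h2 := hℓ (g (r (i + k + 1)))
          rw [hd k, ih] at h2
          rw [← add_assoc]
          push_cast
          omega
      obtain ⟨j, hj, hj1, hj2⟩ := hP (i + ((ℓ (g (r i))).toNat + 1))
      obtain ⟨k, rfl⟩ : ∃ k, j = i + k := ⟨j - i, by omega⟩
      have h3 := hlev k
      have h4 := hlev (k + 1)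
      have h5 := Int.self_le_toNat (ℓ (g (r i)))
      push_cast at h4
      have hKmem : ∀ k', ℓ (g (r (i + k'))) < 0 → i + k' ∈ P → g (r (i + k')) ∈ K := by
        intro k' hneg hk'
        exact (hS'.mem_iff_of_infinite _ (hinf k') hneg).1 ((hg _).2 ((hS.ray_mem_iff _).2 hk'))
      have h6 := hK _ (hKmem k (by omega) hj1) _ (hKmem (k + 1) (by omega) hj2) (by omega)
      have := hinj h6
      omega
  intro v
  obtain ⟨-, h1 | h1⟩ := (h.isParent _ _).1
    (g.map_adj_iff.2 (h.isParent.adj_parent (h.parent_ne v)))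
  · exact h1.symm
  · exfalso
    have hinj : Function.Injective fun k => g (π^[k] v) := by
      refine g.injective.comp ?_
      have key : ∀ a b, π^[a] v ≠ π^[a + b + 1] v := by
        intro a b he
        rw [show a + b + 1 = (b + 1) + a by ring, Function.iterate_add_apply] at he
        exact h.iterate_ne _ b he.symm
      intro a b he
      rcases lt_trichotomy a b with hab | hab | hab
      · obtain ⟨c, rfl⟩ : ∃ c, b = a + c + 1 := ⟨b - a - 1, by omega⟩
        exact absurd he (key a c)
      · exact hab
      · obtain ⟨c, rfl⟩ : ∃ c, a = b + c + 1 := ⟨a - b - 1, by omega⟩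
        exact absurd he.symm (key b c)
    have hadj : ∀ k, T.Adj (g (π^[k] v)) (g (π^[k + 1] v)) := fun k => by
      rw [Function.iterate_succ_apply']
      exact g.map_adj_iff.2 (h.isParent.adj_parent (h.parent_ne _))
    obtain ⟨n, i, hn⟩ := h.reaches v
    have hd := h.descends (i := 0) hinj hadj h1 n
    simp only [zero_add] at hd
    rw [Function.iterate_succ_apply', hn, h.parent_ray, ← hup] at hd
    exact h.iterate_ne (g (r i)) 1 hd

/-- The positions on the ray that are coloured: all but those in a sparse set which encodes `A`. -/
def rayCode (A : Set ℕ) : Set ℕ := {i | ∀ t ∈ A, i ≠ 4 ^ t}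

theorem exists_consecutive_rayCode (A : Set ℕ) (n : ℕ) :
    ∃ i ≥ n, i ∈ rayCode A ∧ i + 1 ∈ rayCode A := by
  have key : ∀ t, 4 ^ t % 4 = 0 ∨ 4 ^ t % 4 = 1 := by
    intro t
    cases t with
    | zero => right; rfl
    | succ t => left; rw [pow_succ]; omega
  refine ⟨4 * n + 2, by omega, fun t _ he => ?_, fun t _ he => ?_⟩
  · have := key t
    omega
  · have := key t
    omega

/-- The code of an infinite set `A` is not shift-equivalent to itself, nor to a code of a set that
is almost disjoint from `A`. -/
theorem rayCode_shift {A A' : Set ℕ} (hA : A.Infinite) {a b : ℕ}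
    (h : ∀ k, a + k ∈ rayCode A ↔ b + k ∈ rayCode A') : a = b ∧ (A ∩ A').Infinite := by
  have key : ∀ t ∈ A, 2 * (a + b) < t → a = b ∧ t ∈ A' := by
    intro t ht hlt
    have h4 : t < 4 ^ t := Nat.lt_pow_self (by norm_num)
    have h1 : a + (4 ^ t - a) ∉ rayCode A := fun hc => hc t ht (by omega)
    rw [h] at h1
    simp only [rayCode, Set.mem_ofPred_eq, not_forall, not_not] at h1
    obtain ⟨t', ht', he⟩ := h1
    rcases lt_trichotomy t t' with hlt' | rfl | hlt'
    · exfalso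
      have : 4 ^ (t + 1) ≤ 4 ^ t' := Nat.pow_le_pow_right (by norm_num) hlt'
      rw [pow_succ] at this
      omega
    · exact ⟨by omega, ht'⟩
    · exfalso
      have : 4 ^ (t' + 1) ≤ 4 ^ t := Nat.pow_le_pow_right (by norm_num) hlt'
      rw [pow_succ] at this
      omega
  have hlarge : ∀ n, ∃ t ∈ A, n < t := fun n => hA.exists_gt n
  obtain ⟨t, ht, hlt⟩ := hlarge (2 * (a + b))
  refine ⟨(key t ht hlt).1, Set.infinite_of_not_bddAbove ?_⟩
  rintro ⟨M, hM⟩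
  obtain ⟨t, ht, hlt⟩ := hlarge (2 * (a + b) + M)
  have := hM ⟨ht, (key t ht (by omega)).2⟩
  omega

/-- The members of an almost disjoint family of sets of natural numbers, indexed by the branches of
the binary tree: the codes of the finite initial segments of `f`. -/
def branchSet (f : ℕ → Bool) : Set ℕ :=
  Set.range fun n => Encodable.encode ((List.range n).map f)

theorem branchSet_infinite (f : ℕ → Bool) : (branchSet f).Infinite := by
  refine Set.infinite_range_of_injective fun a b hab => ?_
  have := congrArg List.length (Encodable.encode_injective hab)
  simpa using this

theorem eq_of_branchSet_inter_infinite {f f' : ℕ → Bool}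
    (h : (branchSet f ∩ branchSet f').Infinite) : f = f' := by
  funext j
  by_contra hj
  refine h (((Set.finite_Iic j).image fun n => Encodable.encode ((List.range n).map f)).subset ?_)
  rintro _ ⟨⟨n, rfl⟩, ⟨n', hn'⟩⟩
  refine ⟨n, ?_, rfl⟩
  have h1 := Encodable.encode_injective hn'
  have h2 := congrArg List.length h1
  simp only [List.length_map, List.length_range] at h2
  subst h2
  by_contra hlt
  simp only [Set.mem_Iic, not_le] at hlt
  have h3 := (List.map_inj_left.1 h1) j (List.mem_range.2 hlt)
  exact hj h3.symm

/-- An automorphism that maps a coded colouring to a coded colouring shifts the ray, from some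
vertex on. -/
theorem IsEndParent.exists_shift (h : IsEndParent T π r) (hS : IsCoded π r ℓ K P S)
    (hS' : IsCoded π r ℓ K P' S') {g : Equiv.Perm V} (hsemi : Function.Semiconj g π π)
    (hg : ∀ x, g x ∈ S' ↔ x ∈ S) :
    ∃ a b, (∀ k, g (r (a + k)) = r (b + k)) ∧ ∀ k, a + k ∈ P ↔ b + k ∈ P' := by
  obtain ⟨a, b, hab⟩ := h.reaches (g (r 0))
  have key : ∀ k, g (r (a + k)) = r (b + k) := by
    intro k
    rw [← h.iterate_ray k b, ← hab, ← Function.iterate_add_apply, add_comm k a,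
      ← hsemi.iterate_right (a + k), h.iterate_ray, zero_add]
  refine ⟨a, b, key, fun k => ?_⟩
  rw [← hS.ray_mem_iff, ← hS'.ray_mem_iff, ← hg, key]

/-- An automorphism that preserves a coded colouring and fixes the vertices of the ray from some
point on is trivial, if the colouring separates the children of every vertex. It preserves the
levels, hence fixes `K`, hence all vertices with infinite branches. -/
theorem IsEndParent.eq_one (h : IsEndParent T π r) (hℓ : ∀ v, ℓ (π v) = ℓ v + 1)
    (hK : ∀ k ∈ K, ¬ (below π k).Finite ∧ ℓ k < 0)
    (hK' : ∀ k ∈ K, ∀ k' ∈ K, ℓ k = ℓ k' ∨ ℓ k = ℓ k' + 1 → k = k')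
    (hK'' : ∀ v, ¬ (below π v).Finite → ∃ k ∈ K, k ∈ below π v)
    (hS : IsCoded π r ℓ K P S) (hsep : ∀ x, SeparatesAt π S x) {g : Equiv.Perm V}
    (hsemi : Function.Semiconj g π π) (hg : ∀ x, g x ∈ S ↔ x ∈ S) {a : ℕ}
    (ha : ∀ k, g (r (a + k)) = r (a + k)) : g = 1 := by
  have hanc : ∀ v, ∃ n, g (π^[n] v) = π^[n] v := by
    intro v
    obtain ⟨n, i, hn⟩ := h.reaches v
    refine ⟨a + n, ?_⟩
    rw [Function.iterate_add_apply, hn, h.iterate_ray, add_comm i a]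
    exact ha i
  have hlev : ∀ v, ℓ (g v) = ℓ v := by
    intro v
    obtain ⟨n, hn⟩ := hanc v
    have h1 := level_iterate hℓ n v
    have h2 := level_iterate hℓ n (g v)
    rw [← hsemi.iterate_right n, hn] at h2
    omega
  refine eq_one_of_separates hsemi hsep hg (fun v hv => ?_) hanc
  obtain ⟨k, hk, n, rfl⟩ := hK'' v hv
  obtain ⟨hkf, hkℓ⟩ := hK k hk
  have hgk : g k ∈ K := by
    refine (hS.mem_iff_of_infinite _ ?_ ?_).1
      ((hg k).2 ((hS.mem_iff_of_infinite k hkf hkℓ).2 hk))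
    · rwa [finite_below_map hsemi]
    · rwa [hlev]
  have : g k = k := hK' _ hgk k hk (Or.inl (hlev k))
  rw [hsemi.iterate_right n, this]

/-- In an infinite tree there are distinguishing sets, indexed by the sequences of booleans, no two
of which are equivalent. -/
theorem TreeBound.exists_family [Infinite V] (hT : TreeBound T m N) :
    ∃ S : (ℕ → Bool) → Set V, (∀ f, T.IsDistinguishing (S f)) ∧
      ∀ f f', ∀ g : T ≃g T, g '' S f = S f' → f = f' := by
  obtain ⟨π, r, h⟩ := exists_isEndParent hT.isTree hT.finite_neighborSet
  have hB := hT.branching h.isParent h.acyclic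
  obtain ⟨ℓ, hℓ, hℓr⟩ := h.exists_level
  have := countable_of_locallyFinite hT.isTree hT.finite_neighborSet
  obtain ⟨K, hK, hK', hK''⟩ := exists_sparse hB.finite_kids hℓ
  have hex : ∀ f : ℕ → Bool, ∃ S, IsCoded π r ℓ K (rayCode (branchSet f)) S ∧
      ∀ x, SeparatesAt π S x := by
    intro f
    obtain ⟨S, hS1, hS2, hS3⟩ := hB.exists_separating_extension h
      (r '' rayCode (branchSet f) ∪ K)
    refine ⟨S, ⟨fun x hx hneg => ?_, fun i => ?_⟩, hS3⟩
    · rw [hS1 x hx, Set.mem_union, or_iff_right]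
      rintro ⟨i, -, rfl⟩
      rw [hℓr] at hneg
      omega
    · rw [hS2 i, Set.mem_union, h.injective.mem_set_image, or_iff_left]
      intro hi
      have := (hK _ hi).2
      rw [hℓr] at this
      omega
  choose S hS hsep using hex
  have key : ∀ f f', ∀ g : T ≃g T, g '' S f = S f' → Function.Semiconj g π π ∧
      (∀ x, g x ∈ S f' ↔ x ∈ S f) ∧ ∃ a, (∀ k, g (r (a + k)) = r (a + k)) ∧
      (branchSet f ∩ branchSet f').Infinite := by
    intro f f' g hgS
    have hg : ∀ x, g x ∈ S f' ↔ x ∈ S f := fun x => by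
      rw [← hgS]; exact g.injective.mem_set_image
    have hsemi := h.semiconj hℓ hK' (exists_consecutive_rayCode _) (hS f) (hS f') g hg
    obtain ⟨a, b, hab, hP⟩ := h.exists_shift (g := g.toEquiv) (hS f) (hS f') hsemi hg
    obtain ⟨rfl, hinf⟩ := rayCode_shift (branchSet_infinite f) hP
    exact ⟨hsemi, hg, a, hab, hinf⟩
  refine ⟨S, fun f g hgS => ?_, fun f f' g hgS => ?_⟩
  · obtain ⟨hsemi, hg, a, ha, -⟩ := key f f g hgS
    have h1 : g.toEquiv = 1 := h.eq_one hℓ hK hK' hK'' (hS f) (hsep f) hsemi hg ha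
    ext x
    exact congrArg (fun e : Equiv.Perm V => e x) h1
  · obtain ⟨-, -, -, -, hinf⟩ := key f f' g hgS
    exact eq_of_branchSet_inter_infinite hinf

theorem TreeBound.asymmetrizingNumber_eq [Infinite V] (hT : TreeBound T m N) :
    T.asymmetrizingNumber = 2 ^ #V := by
  have := countable_of_locallyFinite hT.isTree hT.finite_neighborSet
  obtain ⟨S, hS, hne⟩ := hT.exists_family
  refine le_antisymm ?_ ?_
  · rw [← Cardinal.mk_set]
    exact Cardinal.mk_quotient_le.trans (Cardinal.mk_subtype_le _)
  · have h1 := Cardinal.lift_mk_le_lift_mk_of_injective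
      (f := fun f => (Quotient.mk T.distinguishingSetoid ⟨S f, hS f⟩)) (fun f f' hff => by
        obtain ⟨g, hg⟩ := Quotient.exact hff
        exact hne f f' g hg)
    rw [Cardinal.mk_eq_aleph0 V]
    simpa [SimpleGraph.asymmetrizingNumber] using h1

theorem treeBound_of_hasMotion (hT : T.IsTree) (hm : T.HasMotion (m : Cardinal))
    (hΔ : ((Cardinal.toENat T.degreeSup : ℕ∞) : ℝ≥0∞) ≤ (2 : ℝ≥0∞) ^ ((m : ℝ) / 2)) :
    TreeBound T m (Cardinal.toNat T.degreeSup) := by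
  have hlt : T.degreeSup < ℵ₀ := by
    rw [← Cardinal.toENat_ne_top]
    intro htop
    rw [htop] at hΔ
    simp only [ENat.toENNReal_top, top_le_iff] at hΔ
    exact ENNReal.rpow_ne_top_of_nonneg (by positivity) (by norm_num) hΔ
  have hle : ∀ v, #(T.neighborSet v) ≤ T.degreeSup := fun v =>
    le_ciSup (f := fun v => #(T.neighborSet v)) Cardinal.bddAbove_of_small v
  have hfin : ∀ v, (T.neighborSet v).Finite := fun v =>
    Cardinal.lt_aleph0_iff_set_finite.1 ((hle v).trans_lt hlt)
  refine ⟨hT, fun g hg hgf => ?_, ?_, hfin, fun v => ?_⟩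
  · have h1 : (m : Cardinal) ≤ #{x | g x ≠ x} := hm.2 ⟨g, hg, rfl⟩
    rw [← Set.cast_ncard hgf] at h1
    exact_mod_cast h1
  · have h1 : ((Cardinal.toENat T.degreeSup : ℕ∞) : ℝ≥0∞) = (Cardinal.toNat T.degreeSup : ℝ≥0∞) := by
      conv_lhs => rw [← Cardinal.cast_toNat_of_lt_aleph0 hlt]
      simp
    rw [h1] at hΔ
    have h2 := ENNReal.rpow_le_rpow hΔ (z := (2 : ℝ)) (by norm_num)
    rw [← ENNReal.rpow_mul, div_mul_cancel₀ _ (by norm_num : (2 : ℝ) ≠ 0), ENNReal.rpow_natCast,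
      ENNReal.rpow_ofNat] at h2
    exact_mod_cast h2
  · exact (Cardinal.toNat_le_toNat (hle v) hlt)

end Coding

end ParentMap

theorem theorem3p3 {V : Type*} (T : SimpleGraph V) (hT : T.IsTree) (m : ℕ)
    (hm : T.HasMotion (m : Cardinal))
    (hΔ : ((Cardinal.toENat T.degreeSup : ℕ∞) : ℝ≥0∞) ≤ (2 : ℝ≥0∞) ^ ((m : ℝ) / 2)) :
    T.TwoDistinguishable ∧ (Infinite V → T.asymmetrizingNumber = 2 ^ #V) := by
  have hB := ParentMap.treeBound_of_hasMotion hT hm hΔ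
  refine ⟨?_, fun _ => hB.asymmetrizingNumber_eq⟩
  rcases finite_or_infinite V with hV | hV
  · exact hB.twoDistinguishable_of_finite
  · obtain ⟨S, hS, -⟩ := hB.exists_family
    exact ⟨S fun _ => true, hS _⟩
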